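/- A canonical Local Friendliness (LF) scenario $S=(I_A,I_F,M,O)$ consists of a finite set $I_A=\{1,\dots,N\}$ of parties with $N\ge 2$, for each party $i$ a finite set $M_i=\{1,\dots,m_i\}$ of measurements with $m_i\ge 2$, for each $x_i\in M_i$ a finite set $O_{x_i}$ of outcomes with $|O_{x_i}|\ge 2$, and a subset $I_F\subseteq I_A$ (the parties that have a "friend"). Put $M=\prod_i M_i$ and $O_{\vec x}=\prod_i O_{x_i}$. A behaviour is a family $\wp(\cdot|\vec x)$, $\vec x\in M$, of probability distributions on $O_{\vec x}$. Consider the following sets of behaviours. - $\mathcal{NS}(S)$: for every party $i$, the marginal $\sum_{a_i}\wp(\vec a|\vec x)$ does not depend on $x_i$. - $\mathcal B(S)$: there are a probability space $(\Lambda,\mu)$ and conditional probability distributions $P(a_i|x_i,\lambda)$, measurable in $\lambda$, with $\wp(\vec a|\vec x)=\int_\Lambda\prod_i P(a_i|x_i,\lambda)\,d\mu(\lambda)$. - $\mathcal Q(S)$: there are complex Hilbert spaces $\mathcal H_1,\dots,\mathcal H_N$ (of any dimension), a positive operator $\rho$ of trace one on $\mathcal H_1\otimes\cdots\otimes\mathcal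 H_N$, and positive operators $M_{a_i|x_i}$ on $\mathcal H_i$ with $\sum_{a_i\in O_{x_i}}M_{a_i|x_i}=I$, such that $\wp(\vec a|\vec x)=\mathrm{tr}[(M_{a_1|x_1}\otimes\cdots\otimes M_{a_N|x_N})\rho]$. - $\mathcal{LF}(S)$: there are a probability distribution $P(\vec c)$ on $\prod_{i\in I_F}O_{x_i=1}$ and, for each $\vec c$, a behaviour $P(\vec a|\vec x,\vec c)$ such that for every $V\subseteq I_A$ the marginal on $V$ depends only on $\vec x_V$ (so that $P(\vec a_V|\vec x,\vec c)=P(\vec a_V|\vec x_V,\vec c)$), with $$\wp(\vec a|\vec x)=\sum_{\vec c}\ \prod_{i\in F_{\vec x}}\delta_{a_i,c_i}\cdot P(\vec a_{J_{\vec x}}|\vec x_{J_{\vec x}},\vec c)\cdot P(\vec c),\qquad F_{\vec x}=\{i\in I_F: x_i=1\},\quad J_{\vec x}=I_A\setminus F_{\vec x}.$$ Then for every canonical LF scenario $S$ exactly one of the following three relations holds: 1. $\mathcal Q(S)\subsetneq\mathcal{LF}(S)=\mathcal{NS}(S)$; 2. $\mathcal B(S)=\mathcal{LF}(S)\subsetneq\mathcal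 Q(S)$; 3. $\mathcal{LF}(S)\not\subseteq\mathcal Q(S)$ and $\mathcal Q(S)\not\subseteq\mathcal{LF}(S)$. Moreover, relation 1 holds if and only if $I_F=\emptyset$. -/

import Mathlib

open scoped InnerProductSpace

noncomputable section

/-! ## Canonical Local Friendliness scenarios -/

/-- A canonical (standard) Local Friendliness scenario `S = (I_A, I_F, M, O)`.
Parties are `Fin N`, the measurements of party `i` are `Fin (numMeas i)`, the outcomes of
measurement `s` of party `i` are `Fin (numOut i s)`, and `friends` is the set of parties
that have a friend. All labels start at `0` here. -/
structure LFScenario where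
  N : ℕ
  numMeas : Fin N → ℕ
  numOut : (i : Fin N) → Fin (numMeas i) → ℕ
  friends : Finset (Fin N)
  two_le_N : 2 ≤ N
  two_le_numMeas : ∀ i, 2 ≤ numMeas i
  two_le_numOut : ∀ i s, 2 ≤ numOut i s

namespace LFScenario

variable (S : LFScenario)

/-- Strings of measurement choices `x ∈ M = M_1 × ⋯ × M_N`. -/
abbrev Inputs : Type := (i : Fin S.N) → Fin (S.numMeas i)

/-- Strings of outcomes `a ∈ O_x = O_{x_1} × ⋯ × O_{x_N}` in the context `x`. -/
abbrev Outputs (x : S.Inputs) : Type := (i : Fin S.N) → Fin (S.numOut i (x i))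

/-- Families `p(a|x)` of real numbers, indexed by contexts and outcome strings. -/
abbrev Table : Type := (x : S.Inputs) → S.Outputs x → ℝ

/-- The first measurement of party `i`; for a party with a friend it is the query measurement. -/
def query (i : Fin S.N) : Fin (S.numMeas i) :=
  ⟨0, lt_of_lt_of_le Nat.zero_lt_two (S.two_le_numMeas i)⟩

/-- A behaviour: one probability distribution over the outcome strings for each context. -/
def IsBehaviour (p : S.Table) : Prop :=
  (∀ x a, 0 ≤ p x a) ∧ ∀ x, ∑ a, p x a = 1

/-- The marginal `p(a_V|x)`: the sum of `p(a'|x)` over all `a'` that agree with `a` on `V`. -/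
def marginal (p : S.Table) (V : Finset (Fin S.N)) (x : S.Inputs) (a : S.Outputs x) : ℝ :=
  ∑ a' : S.Outputs x, if ∀ i ∈ V, a' i = a i then p x a' else 0

/-- The marginal of `p` on `V` does not depend on the measurement choices outside `V`:
`p(a_V|x) = p(a_V|x')` whenever `x` and `x'` agree on `V`. As the outcome strings `a` and `a'`
live in different contexts, their entries are compared as natural numbers. -/
def MarginalIndependent (p : S.Table) (V : Finset (Fin S.N)) : Prop :=
  ∀ (x x' : S.Inputs) (a : S.Outputs x) (a' : S.Outputs x'),
    (∀ i ∈ V, x i = x' i) → (∀ i ∈ V, (a i : ℕ) = (a' i : ℕ)) →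
      S.marginal p V x a = S.marginal p V x' a'

/-! ## No-signalling behaviours -/

/-- `NS(S)`: summing over the outcome of any single party `i` removes the dependence
on the measurement choice of `i`. -/
def noSignalling : Set S.Table :=
  {p | S.IsBehaviour p ∧ ∀ i, S.MarginalIndependent p (Finset.univ.erase i)}

/-! ## Bell-local behaviours -/

/-- `B(S)`: behaviours with a local hidden variable model
`p(a|x) = ∫ ∏ i, P(a_i|x_i, l) dμ(l)` over some probability space. -/
def bellLocal : Set S.Table :=
  {p | S.IsBehaviour p ∧
    ∃ (L : Type) (_ : MeasurableSpace L) (μ : MeasureTheory.Measure L)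
      (P : (i : Fin S.N) → (s : Fin (S.numMeas i)) → Fin (S.numOut i s) → L → ℝ),
      MeasureTheory.IsProbabilityMeasure μ ∧
      (∀ i s c, Measurable (P i s c)) ∧
      (∀ i s c l, 0 ≤ P i s c l) ∧
      (∀ i s l, ∑ c, P i s c l = 1) ∧
      ∀ x a, p x a = ∫ l, ∏ i, P i (x i) (a i) l ∂μ}

/-! ## Local Friendliness behaviours -/

/-- Strings `c` of outcomes recorded by the friends. -/
abbrev FriendOutcomes : Type := (i : S.friends) → Fin (S.numOut i.1 (S.query i.1))

/-- `F_x`: the parties with a friend that choose the query measurement in the context `x`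
(as a set of elements of `I_F`). -/
def queried (x : S.Inputs) : Finset S.friends :=
  Finset.univ.filter fun i => x i.1 = S.query i.1

/-- `J_x = I_A \ F_x`. -/
def unqueried (x : S.Inputs) : Finset (Fin S.N) :=
  Finset.univ.filter fun i => ¬ (i ∈ S.friends ∧ x i = S.query i)

/-- Local Agency for a family of distributions `P(a|x)`: for every set `V` of parties,
`P(a_V|x)` depends only on `x_V`. -/
def LocalAgency (p : S.Table) : Prop :=
  ∀ V : Finset (Fin S.N), S.MarginalIndependent p V

/-- `LF(S)`: behaviours of the form
`p(a|x) = ∑ c, (∏ i ∈ F_x, δ_{a_i, c_i}) * P(a_{J_x}|x_{J_x}, c) * P(c)`,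
where `P(c)` is a probability distribution and every `P(·|·, c)` is a family of
distributions that satisfies Local Agency. -/
def localFriendliness : Set S.Table :=
  {p | S.IsBehaviour p ∧
    ∃ (w : S.FriendOutcomes → ℝ) (P : S.FriendOutcomes → S.Table),
      (∀ c, 0 ≤ w c) ∧ ∑ c, w c = 1 ∧
      (∀ c, S.IsBehaviour (P c)) ∧
      (∀ c, S.LocalAgency (P c)) ∧
      ∀ x a, p x a = ∑ c,
        (∏ i ∈ S.queried x, if (a i.1 : ℕ) = (c i : ℕ) then (1 : ℝ) else 0) *
          S.marginal (P c) (S.unqueried x) x a * w c}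

end LFScenario

/-! ## Hilbert space tensor products and traces -/

section HilbertTensor

variable {ι : Type} [Fintype ι] {H : ι → Type} [∀ i, NormedAddCommGroup (H i)]
  [∀ i, InnerProductSpace ℂ (H i)] {K : Type} [NormedAddCommGroup K] [InnerProductSpace ℂ K]

/-- `K`, with `t u` in the role of `⨂ i, u i`, is the Hilbert space tensor product of the
spaces `H i`. This determines `(K, t)` up to a unique unitary. -/
structure IsHilbertTensorProduct (t : MultilinearMap ℂ H K) : Prop where
  inner_tprod : ∀ u v : (i : ι) → H i, ⟪t u, t v⟫_ℂ = ∏ i, ⟪u i, v i⟫_ℂ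
  dense_span : Dense (Submodule.span ℂ (Set.range t) : Set K)

/-- The bounded operator `T` is the tensor product `⨂ i, A i`. -/
def IsTensorOperator (t : MultilinearMap ℂ H K) (A : (i : ι) → H i →L[ℂ] H i)
    (T : K →L[ℂ] K) : Prop :=
  ∀ u : (i : ι) → H i, T (t u) = t fun i => A i (u i)

theorem IsHilbertTensorProduct.operator_unique {t : MultilinearMap ℂ H K}
    (ht : IsHilbertTensorProduct t) {A : (i : ι) → H i →L[ℂ] H i} {T T' : K →L[ℂ] K}
    (hT : IsTensorOperator t A T) (hT' : IsTensorOperator t A T') : T = T' := by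
  refine ContinuousLinearMap.ext_on ht.dense_span ?_
  rintro _ ⟨u, rfl⟩
  rw [hT u, hT' u]

theorem IsHilbertTensorProduct.exists_operator_of_unitary [CompleteSpace K]
    [∀ i, CompleteSpace (H i)] {t : MultilinearMap ℂ H K}
    (ht : IsHilbertTensorProduct t) (A : (i : ι) → H i →L[ℂ] H i)
    (hA : ∀ i, A i ∈ unitary (H i →L[ℂ] H i)) : ∃ T, IsTensorOperator t A T := by
  let e : (((i : ι) → H i) →₀ ℂ) →ₗ[ℂ] K := Finsupp.linearCombination ℂ t
  let f : (((i : ι) → H i) →₀ ℂ) →ₗ[ℂ] K :=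
    Finsupp.linearCombination ℂ fun u => t fun i => A i (u i)
  have hin : ∀ i (x y : H i), ⟪A i x, A i y⟫_ℂ = ⟪x, y⟫_ℂ := by
    intro i x y
    have h1 : (ContinuousLinearMap.adjoint (A i)) * A i = 1 := (Unitary.mem_iff.1 (hA i)).1
    rw [← ContinuousLinearMap.adjoint_inner_right]
    have h2 : (ContinuousLinearMap.adjoint (A i)) (A i y) = y := by
      simpa using congrArg (fun B : H i →L[ℂ] H i => B y) h1
    rw [h2]
  have hd : DenseRange e := by
    have : Set.range e = (Submodule.span ℂ (Set.range t) : Set K) := by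
      rw [← Finsupp.range_linearCombination]; rfl
    rw [DenseRange, this]
    exact ht.dense_span
  have hn : ∀ g, ‖f g‖ = ‖e g‖ := by
    intro g
    have h : ⟪f g, f g⟫_ℂ = ⟪e g, e g⟫_ℂ := by
      simp only [f, e, Finsupp.linearCombination_apply, Finsupp.sum, sum_inner, inner_sum,
        inner_smul_left, inner_smul_right, ht.inner_tprod, hin]
    rw [inner_self_eq_norm_sq_to_K, inner_self_eq_norm_sq_to_K] at h
    have h' : ‖f g‖ ^ 2 = ‖e g‖ ^ 2 := by exact_mod_cast h
    exact (pow_left_inj₀ (norm_nonneg _) (norm_nonneg _) two_ne_zero).1 h'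
  refine ⟨f.extendOfNorm e, fun u => ?_⟩
  have h := LinearMap.extendOfNorm_eq (f := f) (e := e) hd ⟨1, fun g => by rw [hn g, one_mul]⟩
    (Finsupp.single u 1)
  simpa [e, f] using h

theorem IsHilbertTensorProduct.exists_operator [CompleteSpace K]
    [∀ i, CompleteSpace (H i)] {t : MultilinearMap ℂ H K}
    (ht : IsHilbertTensorProduct t) (A : (i : ι) → H i →L[ℂ] H i) :
    ∃ T, IsTensorOperator t A T := by
  classical
  suffices h : ∀ (s : Finset ι) (A : (i : ι) → H i →L[ℂ] H i),
      (∀ i, i ∉ s → A i ∈ unitary (H i →L[ℂ] H i)) → ∃ T, IsTensorOperator t A T from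
    h Finset.univ A fun i hi => absurd (Finset.mem_univ i) hi
  intro s
  induction s using Finset.induction_on with
  | empty => exact fun A hA => ht.exists_operator_of_unitary A fun i => hA i (Finset.notMem_empty i)
  | insert j s hj ih =>
    intro A hA
    have key : ∀ (B : H j →L[ℂ] H j) (u : (i : ι) → H i),
        (t fun i => Function.update A j B i (u i)) =
          t (Function.update (fun i => A i (u i)) j (B (u j))) := by
      intro B u
      congr 1
      funext i
      by_cases h : i = j
      · subst h; simp
      · simp [h]
    have hspan : ∀ B ∈ Submodule.span ℂ (unitary (H j →L[ℂ] H j) : Set (H j →L[ℂ] H j)),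
        ∃ T, IsTensorOperator t (Function.update A j B) T := by
      intro B hB
      induction hB using Submodule.span_induction with
      | mem B hB =>
        refine ih _ fun i hi => ?_
        by_cases h : i = j
        · subst h; simpa using hB
        · rw [Function.update_of_ne h]
          exact hA i fun h' => (Finset.mem_insert.1 h').elim h hi
      | zero =>
        refine ⟨0, fun u => ?_⟩
        rw [key]
        simp
      | add B C _ _ hB hC =>
        obtain ⟨T, hT⟩ := hB
        obtain ⟨U, hU⟩ := hC
        refine ⟨T + U, fun u => ?_⟩
        rw [key, add_apply, add_apply,
          MultilinearMap.map_update_add, hT u, hU u, key, key]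
      | smul c B _ hB =>
        obtain ⟨T, hT⟩ := hB
        refine ⟨c • T, fun u => ?_⟩
        rw [key, smul_apply, smul_apply,
          MultilinearMap.map_update_smul, hT u, key]
    have hAj : A j ∈ Submodule.span ℂ (unitary (H j →L[ℂ] H j) : Set (H j →L[ℂ] H j)) := by
      rw [CStarAlgebra.span_unitary]
      exact Submodule.mem_top
    simpa using hspan (A j) hAj

/-- The tensor product operator `⨂ i, A i` on `K`; it exists and is unique. -/
def tensorOperator [CompleteSpace K] [∀ i, CompleteSpace (H i)] {t : MultilinearMap ℂ H K}
    (ht : IsHilbertTensorProduct t) (A : (i : ι) → H i →L[ℂ] H i) : K →L[ℂ] K :=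
  (ht.exists_operator A).choose

theorem tensorOperator_spec [CompleteSpace K] [∀ i, CompleteSpace (H i)]
    {t : MultilinearMap ℂ H K} (ht : IsHilbertTensorProduct t) (A : (i : ι) → H i →L[ℂ] H i) :
    IsTensorOperator t A (tensorOperator ht A) :=
  (ht.exists_operator A).choose_spec

/-- The bounded operator `A` has trace `c`: the sum of its diagonal entries converges to `c` in
every Hilbert basis. (This holds for some `c` exactly when `A` is of trace class.) -/
def HasTrace (A : K →L[ℂ] K) (c : ℂ) : Prop :=
  ∀ (s : Set K) (b : HilbertBasis s ℂ K), HasSum (fun k => ⟪b k, A (b k)⟫_ℂ) c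

end HilbertTensor

/-! ## Quantum behaviours -/

namespace LFScenario

variable (S : LFScenario)

/-- A quantum model: a complex Hilbert space `H i` (of any dimension) for each party, their
Hilbert space tensor product `K`, a density operator on `K`, and a POVM on `H i` for every
measurement of party `i`. -/
structure QuantumModel where
  H : Fin S.N → Type
  [normH : ∀ i, NormedAddCommGroup (H i)]
  [innerH : ∀ i, InnerProductSpace ℂ (H i)]
  [completeH : ∀ i, CompleteSpace (H i)]
  K : Type
  [normK : NormedAddCommGroup K]
  [innerK : InnerProductSpace ℂ K]
  [completeK : CompleteSpace K]
  tprod : MultilinearMap ℂ H K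
  isTensor : IsHilbertTensorProduct tprod
  state : K →L[ℂ] K
  state_pos : state.IsPositive
  state_trace : HasTrace state 1
  povm : (i : Fin S.N) → (s : Fin (S.numMeas i)) → Fin (S.numOut i s) → H i →L[ℂ] H i
  povm_pos : ∀ i s c, (povm i s c).IsPositive
  povm_sum : ∀ i s, ∑ c, povm i s c = ContinuousLinearMap.id ℂ (H i)

attribute [instance] QuantumModel.normH QuantumModel.innerH QuantumModel.completeH
  QuantumModel.normK QuantumModel.innerK QuantumModel.completeK

/-- `Q(S)`: behaviours given by the Born rule
`p(a|x) = tr[(⨂ i, M_{a_i|x_i}) ρ]` for some quantum model. -/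
def quantum : Set S.Table :=
  {p | S.IsBehaviour p ∧ ∃ m : S.QuantumModel, ∀ x a,
    HasTrace (tensorOperator m.isTensor (fun i => m.povm i (x i) (a i)) ∘L m.state)
      ((p x a : ℝ) : ℂ)}

/-! ## The three possible relations between `Q(S)` and `LF(S)` -/

/-- `Q(S) ⊊ LF(S) = NS(S)`. -/
def QuantumInsideLF : Prop :=
  S.quantum ⊂ S.localFriendliness ∧ S.localFriendliness = S.noSignalling

/-- `B(S) = LF(S) ⊊ Q(S)`. -/
def LFInsideQuantum : Prop :=
  S.bellLocal = S.localFriendliness ∧ S.localFriendliness ⊂ S.quantum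

/-- Neither of `LF(S)` and `Q(S)` contains the other. -/
def Incomparable : Prop :=
  ¬ S.localFriendliness ⊆ S.quantum ∧ ¬ S.quantum ⊆ S.localFriendliness

end LFScenario

end

/-! Without friends the string `c` carries no information, and LF = NS because no-signalling for
single parties already gives Local Agency for all sets of parties (`localAgency_of_noSignalling`).
Quantum behaviours are no-signalling, while a Popescu–Rohrlich (PR) box is no-signalling but not
quantum (`prBox_notMem_quantum`). This is relation 1.

If some party j has a friend, then Q is not contained in LF
(`not_quantum_subset_localFriendliness`): given `c`, the query outcome of j is fixed, and this
determinism, together with Local Agency, is all that the possibilistic argument of Hardy needs; two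
qubits realise Hardy's paradox with the query of j as one of the measurements. So relation 1 fails,
and everything turns on whether LF ⊆ Q. If not, relation 3 holds.

If LF ⊆ Q, it remains to prove LF = B. Call a party free if it has two measurements whose outcomes
are not fixed by `c`. A PR box between two free parties is in LF but not in Q, so all parties except
at most one, k, are not free: each of them has a friend and a single measurement besides the query.
For fixed `c`, the joint outcome of these remaining measurements serves as hidden variable, and k
answers with its conditional distribution (`LocalAgency.exists_local_model`). Hence LF ⊆ B. The
inclusion B ⊆ LF always holds: condition the hidden variable on the query outcomes of the friends
(`bellLocal_subset_localFriendliness`).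

Both non-membership proofs use only which probabilities vanish, never a numerical inequality. On the
quantum side, an event of probability zero has an effect that annihilates the state
(`eq_zero_of_hasTrace_eq_zero`). -/

namespace LFScenario

variable {S : LFScenario}

/-! ## Marginals and transport of outcome strings -/

/-- The outcome string of the context `x'` that has the values of `a` wherever `x` and `x'` agree
and the value `0` elsewhere. -/
def transport {x : S.Inputs} (x' : S.Inputs) (a : S.Outputs x) : S.Outputs x' := fun i =>
  if h : x i = x' i then Fin.cast (by rw [h]) (a i)
  else ⟨0, lt_of_lt_of_le Nat.zero_lt_two (S.two_le_numOut i (x' i))⟩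

theorem transport_val {x x' : S.Inputs} (a : S.Outputs x) {i : Fin S.N} (h : x i = x' i) :
    (transport x' a i : ℕ) = a i := by
  simp [transport, h]

theorem transport_val_of_ne {x x' : S.Inputs} (a : S.Outputs x) {i : Fin S.N} (h : x i ≠ x' i) :
    (transport x' a i : ℕ) = 0 := by
  simp [transport, h]

theorem marginal_univ (p : S.Table) (x : S.Inputs) (a : S.Outputs x) :
    S.marginal p Finset.univ x a = p x a := by
  simp [marginal, ← funext_iff]

theorem marginal_nonneg {p : S.Table} (hp : S.IsBehaviour p) (V : Finset (Fin S.N))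
    (x : S.Inputs) (a : S.Outputs x) : 0 ≤ S.marginal p V x a :=
  Finset.sum_nonneg fun b _ => by split_ifs; exacts [hp.1 x b, le_rfl]

theorem le_marginal {p : S.Table} (hp : S.IsBehaviour p) (V : Finset (Fin S.N))
    (x : S.Inputs) (a : S.Outputs x) : p x a ≤ S.marginal p V x a := by
  have h := Finset.single_le_sum (s := Finset.univ)
    (f := fun b : S.Outputs x => if ∀ i ∈ V, b i = a i then p x b else 0)
    (fun b _ => by beta_reduce; split_ifs; exacts [hp.1 x b, le_rfl]) (Finset.mem_univ a)
  simpa [marginal] using h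

theorem marginal_congr (p : S.Table) (V : Finset (Fin S.N)) (x : S.Inputs) {a b : S.Outputs x}
    (h : ∀ i ∈ V, a i = b i) : S.marginal p V x a = S.marginal p V x b := by
  refine Finset.sum_congr rfl fun e _ => ?_
  have : (∀ i ∈ V, e i = a i) ↔ ∀ i ∈ V, e i = b i :=
    forall₂_congr fun i hi => by rw [h i hi]
  simp only [this]

theorem marginal_sum {ι : Type*} (s : Finset ι) (w : ι → ℝ) (Q : ι → S.Table) (V : Finset (Fin S.N))
    (x : S.Inputs) (a : S.Outputs x) :
    S.marginal (fun x a => ∑ c ∈ s, Q c x a * w c) V x a =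
      ∑ c ∈ s, S.marginal (Q c) V x a * w c := by
  simp only [marginal, Finset.sum_mul]
  rw [Finset.sum_comm]
  refine Finset.sum_congr rfl fun b _ => ?_
  split_ifs <;> simp

/-- If a value of the outcome of party `i` is possible in one context, it is possible in every
context with the same measurement choice of `i`. -/
theorem LocalAgency.exists_support {Q : S.Table} (hQ : S.IsBehaviour Q) (hL : S.LocalAgency Q)
    {x x' : S.Inputs} {i : Fin S.N} (hx : x i = x' i) {a : S.Outputs x} (ha : Q x a ≠ 0) :
    ∃ a' : S.Outputs x', Q x' a' ≠ 0 ∧ (a' i : ℕ) = a i := by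
  have h1 : 0 < S.marginal Q {i} x a :=
    lt_of_lt_of_le (lt_of_le_of_ne (hQ.1 x a) ha.symm) (le_marginal hQ _ x a)
  rw [hL {i} x x' a (transport x' a) (by simpa using hx)
    (by simpa using (transport_val a hx).symm)] at h1
  obtain ⟨b, -, hb⟩ := Finset.exists_ne_zero_of_sum_ne_zero h1.ne'
  have hc : ∀ l ∈ ({i} : Finset (Fin S.N)), b l = transport x' a l := by
    by_contra h
    exact hb (if_neg h)
  rw [if_pos hc] at hb
  exact ⟨b, hb, by rw [hc i (by simp), transport_val a hx]⟩

/-! ## No-signalling implies Local Agency -/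

/-- The classes of outcome strings that agree off `i` are represented by the strings with value `0`
at `i`, so that each class is counted once. -/
theorem marginal_eq_sum_erase (p : S.Table) {V : Finset (Fin S.N)} {i : Fin S.N} (hi : i ∉ V)
    (x : S.Inputs) (a : S.Outputs x) :
    S.marginal p V x a = ∑ e : S.Outputs x, if (e i : ℕ) = 0 ∧ ∀ l ∈ V, e l = a l then
      S.marginal p (Finset.univ.erase i) x e else 0 := by
  simp only [marginal]
  simp_rw [← Finset.sum_filter (p := fun e : S.Outputs x => (e i : ℕ) = 0 ∧ ∀ l ∈ V, e l = a l)]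
  rw [Finset.sum_comm]
  refine Finset.sum_congr rfl fun b _ => ?_
  let z : Fin (S.numOut i (x i)) := ⟨0, lt_of_lt_of_le Nat.zero_lt_two (S.two_le_numOut i (x i))⟩
  have hu : ∀ e : S.Outputs x, ((e i : ℕ) = 0 ∧ ∀ l ∈ Finset.univ.erase i, b l = e l) ↔
      e = Function.update b i z := by
    intro e
    constructor
    · rintro ⟨h0, h1⟩
      funext l
      by_cases hl : l = i
      · subst hl; simpa [z, Fin.ext_iff] using h0
      · rw [Function.update_of_ne hl, h1 l (by simp [hl])]
    · rintro rfl
      refine ⟨by simp [z], fun l hl => ?_⟩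
      rw [Function.update_of_ne (Finset.ne_of_mem_erase hl)]
  have hv : (∀ l ∈ V, Function.update b i z l = a l) ↔ ∀ l ∈ V, b l = a l :=
    forall₂_congr fun l hl => by
      rw [Function.update_of_ne (show l ≠ i by rintro rfl; exact hi hl)]
  rw [Finset.sum_filter]
  have : ∀ e : S.Outputs x,
      (if (e i : ℕ) = 0 ∧ ∀ l ∈ V, e l = a l then
        if ∀ l ∈ Finset.univ.erase i, b l = e l then p x b else 0 else 0) =
      if e = Function.update b i z then if ∀ l ∈ V, b l = a l then p x b else 0 else 0 := by
    intro e
    by_cases he : e = Function.update b i z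
    · have h' := (hu e).2 he
      rw [if_pos he, if_pos h'.2]
      simp only [h'.1, true_and]
      rw [he]
      simp only [hv]
    · rw [if_neg he]
      have h' := mt (hu e).1 he
      split_ifs with h1 h2
      · exact absurd ⟨h1.1, h2⟩ h'
      · rfl
      · rfl
  simp only [this, Finset.sum_ite_eq', Finset.mem_univ, if_true]

/-- Both sides are expanded by `marginal_eq_sum_erase`. The representatives have value `0` at `i`,
so `transport` matches them bijectively even when the two measurements of `i` have different numbers
of outcomes. -/
theorem marginal_eq_of_differ_at {p : S.Table} {i : Fin S.N}
    (hp : S.MarginalIndependent p (Finset.univ.erase i)) {V : Finset (Fin S.N)} (hi : i ∉ V)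
    {x x' : S.Inputs} (hx : ∀ l, l ≠ i → x l = x' l) {a : S.Outputs x} {a' : S.Outputs x'}
    (ha : ∀ l ∈ V, (a l : ℕ) = a' l) : S.marginal p V x a = S.marginal p V x' a' := by
  by_cases hxx : x = x'
  · subst hxx
    exact marginal_congr p V x fun l hl => Fin.ext (ha l hl)
  have hxi : x i ≠ x' i := fun h => hxx (funext fun l => by
    by_cases hl : l = i
    · rw [hl, h]
    · exact hx l hl)
  rw [marginal_eq_sum_erase p hi, marginal_eq_sum_erase p hi, ← Finset.sum_filter,
    ← Finset.sum_filter]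
  have key : ∀ (x x' : S.Inputs) (a : S.Outputs x) (a' : S.Outputs x') (_ : ∀ l, l ≠ i → x l = x' l)
      (_ : x i ≠ x' i) (_ : ∀ l ∈ V, (a l : ℕ) = a' l) (e : S.Outputs x),
      ((e i : ℕ) = 0 ∧ ∀ l ∈ V, e l = a l) →
      (((transport x' e i : ℕ) = 0 ∧ ∀ l ∈ V, transport x' e l = a' l) ∧
        transport x (transport x' e) = e) := by
    intro x x' a a' hx hxi ha e he
    refine ⟨⟨transport_val_of_ne e hxi, fun l hl => Fin.ext ?_⟩, funext fun l => Fin.ext ?_⟩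
    · rw [transport_val e (hx l fun h => hi (h ▸ hl)), he.2 l hl, ha l hl]
    · by_cases hl : l = i
      · subst hl
        rw [transport_val_of_ne _ hxi.symm, he.1]
      · rw [transport_val _ (hx l hl).symm, transport_val e (hx l hl)]
  have hx' : ∀ l, l ≠ i → x' l = x l := fun l hl => (hx l hl).symm
  have ha' : ∀ l ∈ V, (a' l : ℕ) = a l := fun l hl => (ha l hl).symm
  refine Finset.sum_bij' (fun e _ => transport x' e) (fun e _ => transport x e) ?_ ?_ ?_ ?_ ?_
  · intro e he
    simp only [Finset.mem_filter, Finset.mem_univ, true_and] at he ⊢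
    exact (key x x' a a' hx hxi ha e he).1
  · intro e he
    simp only [Finset.mem_filter, Finset.mem_univ, true_and] at he ⊢
    exact (key x' x a' a hx' hxi.symm ha' e he).1
  · intro e he
    simp only [Finset.mem_filter, Finset.mem_univ, true_and] at he
    exact (key x x' a a' hx hxi ha e he).2
  · intro e he
    simp only [Finset.mem_filter, Finset.mem_univ, true_and] at he
    exact (key x' x a' a hx' hxi.symm ha' e he).2
  · intro e he
    exact hp x x' e _ (fun l hl => hx l (Finset.ne_of_mem_erase hl))
      fun l hl => (transport_val e (hx l (Finset.ne_of_mem_erase hl))).symm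

theorem localAgency_of_noSignalling {p : S.Table} (hp : p ∈ S.noSignalling) : S.LocalAgency p := by
  intro V
  -- The settings outside `V` are changed one party at a time; `D` contains all parties at which the
  -- contexts may still differ.
  suffices h : ∀ (D : Finset (Fin S.N)) (x x' : S.Inputs) (a : S.Outputs x) (a' : S.Outputs x'),
      Disjoint D V → (∀ l ∉ D, x l = x' l) → (∀ i ∈ V, (a i : ℕ) = (a' i : ℕ)) →
      S.marginal p V x a = S.marginal p V x' a' by
    intro x x' a a' hx ha
    refine h Vᶜ x x' a a' disjoint_compl_left (fun l hl => hx l (by simpa using hl)) ha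
  intro D
  induction D using Finset.induction_on with
  | empty =>
    intro x x' a a' _ hx ha
    obtain rfl : x = x' := funext fun l => hx l (by simp)
    exact marginal_congr p V x fun l hl => Fin.ext (ha l hl)
  | insert i D _ ih =>
    intro x x' a a' hD hx ha
    rw [Finset.disjoint_insert_left] at hD
    have hxi : ∀ l, l ≠ i → Function.update x i (x' i) l = x l := fun l hl =>
      Function.update_of_ne hl _ _
    have hne : ∀ l ∈ V, l ≠ i := fun l hl h => hD.1 (h ▸ hl)
    let b : S.Outputs (Function.update x i (x' i)) := transport _ a
    have hb : ∀ l ∈ V, (b l : ℕ) = a l := fun l hl => transport_val a (hxi l (hne l hl)).symm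
    rw [marginal_eq_of_differ_at (hp.2 i) hD.1 (fun l hl => (hxi l hl).symm)
      (fun l hl => (hb l hl).symm) (a' := b)]
    refine ih _ x' b a' hD.2 (fun l hl => ?_) fun l hl => by rw [hb l hl, ha l hl]
    by_cases hl' : l = i
    · subst hl'; simp
    · rw [hxi l hl', hx l (by simp [hl', hl])]

/-! ## A symmetric form of Local Friendliness models -/

/-- Replace the outcomes of the queried friends by `c`. -/
def overwrite (c : S.FriendOutcomes) (x : S.Inputs) (a : S.Outputs x) : S.Outputs x := fun i =>
  if h : i ∈ S.friends ∧ x i = S.query i then Fin.cast (congrArg (S.numOut i) h.2.symm) (c ⟨i, h.1⟩) else a i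

/-- The distribution of the outcomes when the queried friends report `c`. -/
def reported (P : S.Table) (c : S.FriendOutcomes) : S.Table := fun x a =>
  ∑ b, if overwrite c x b = a then P x b else 0

theorem overwrite_eq_iff (c : S.FriendOutcomes) (x : S.Inputs) (a b : S.Outputs x)
    (V : Finset (Fin S.N)) : (∀ i ∈ V, overwrite c x b i = a i) ↔
      (∀ i : S.friends, i.1 ∈ V → x i.1 = S.query i.1 → (a i.1 : ℕ) = c i) ∧
        ∀ i ∈ V ∩ S.unqueried x, b i = a i := by
  constructor
  · intro h
    refine ⟨fun i hi hq => ?_, fun i hi => ?_⟩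
    · rw [← h i.1 hi, overwrite, dif_pos ⟨i.2, hq⟩]
      rfl
    · simp only [unqueried, Finset.mem_inter, Finset.mem_filter, Finset.mem_univ, true_and] at hi
      rw [← h i hi.1, overwrite, dif_neg hi.2]
  · rintro ⟨h1, h2⟩ i hi
    by_cases hq : i ∈ S.friends ∧ x i = S.query i
    · rw [overwrite, dif_pos hq]
      exact Fin.ext (h1 ⟨i, hq.1⟩ hi hq.2).symm
    · rw [overwrite, dif_neg hq]
      exact h2 i (Finset.mem_inter.2 ⟨hi, Finset.mem_filter.2 ⟨Finset.mem_univ i, hq⟩⟩)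

/-- The event splits into a deterministic condition on the queried friends in `V` and an event for
the unqueried parties in `V`. Both depend only on the settings in `V`, which is why reporting
preserves Local Agency. -/
theorem marginal_reported (P : S.Table) (c : S.FriendOutcomes) (V : Finset (Fin S.N))
    (x : S.Inputs) (a : S.Outputs x) :
    S.marginal (reported P c) V x a =
      (if ∀ i : S.friends, i.1 ∈ V → x i.1 = S.query i.1 → (a i.1 : ℕ) = c i then 1 else 0) *
        S.marginal P (V ∩ S.unqueried x) x a := by
  have h1 : S.marginal (reported P c) V x a =
      ∑ b, if ∀ i ∈ V, overwrite c x b i = a i then P x b else 0 := by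
    simp only [marginal, reported]
    simp_rw [← Finset.sum_filter (p := fun a' : S.Outputs x => ∀ i ∈ V, a' i = a i)]
    rw [Finset.sum_comm]
    refine Finset.sum_congr rfl fun b _ => ?_
    rw [Finset.sum_ite_eq]
    simp
  rw [h1, marginal, Finset.mul_sum]
  refine Finset.sum_congr rfl fun b _ => ?_
  simp only [overwrite_eq_iff]
  split_ifs <;> simp_all

theorem reported_eq (P : S.Table) (c : S.FriendOutcomes) (x : S.Inputs) (a : S.Outputs x) :
    reported P c x a = (∏ i ∈ S.queried x, if (a i.1 : ℕ) = (c i : ℕ) then (1 : ℝ) else 0) *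
      S.marginal P (S.unqueried x) x a := by
  rw [← marginal_univ (reported P c), marginal_reported, Finset.univ_inter]
  congr 1
  rw [Finset.prod_ite_zero]
  simp [queried]

theorem isBehaviour_reported {P : S.Table} (hP : S.IsBehaviour P) (c : S.FriendOutcomes) :
    S.IsBehaviour (reported P c) := by
  refine ⟨fun x a => Finset.sum_nonneg fun b _ => ?_, fun x => ?_⟩
  · split_ifs; exacts [hP.1 x b, le_rfl]
  · simp only [reported]
    rw [Finset.sum_comm]
    simp [hP.2 x]

theorem localAgency_reported {P : S.Table} (hP : S.LocalAgency P) (c : S.FriendOutcomes) :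
    S.LocalAgency (reported P c) := by
  intro V x x' a a' hx ha
  rw [marginal_reported, marginal_reported]
  have hV : V ∩ S.unqueried x = V ∩ S.unqueried x' := by
    ext i
    simp only [unqueried, Finset.mem_inter, Finset.mem_filter, Finset.mem_univ, true_and]
    exact and_congr_right fun hi => by rw [hx i hi]
  rw [hV, hP _ x x' a a' (fun i hi => hx i (Finset.mem_inter.1 hi).1)
    fun i hi => ha i (Finset.mem_inter.1 hi).1]
  congr 1
  have : (∀ i : S.friends, i.1 ∈ V → x i.1 = S.query i.1 → (a i.1 : ℕ) = c i) ↔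
      ∀ i : S.friends, i.1 ∈ V → x' i.1 = S.query i.1 → (a' i.1 : ℕ) = c i :=
    forall_congr' fun i => forall_congr' fun hi => by rw [ha i.1 hi, hx i.1 hi]
  simp only [this]

theorem eq_reported_self {Q : S.Table} {c : S.FriendOutcomes}
    (hQ : ∀ x a, Q x a ≠ 0 → ∀ i : S.friends, x i.1 = S.query i.1 → (a i.1 : ℕ) = c i)
    (x : S.Inputs) (a : S.Outputs x) : reported Q c x a = Q x a := by
  have h : ∀ b, (if overwrite c x b = a then Q x b else 0) = if b = a then Q x b else 0 := by
    intro b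
    by_cases hb : Q x b = 0
    · simp [hb]
    · have : overwrite c x b = b := by
        have := (overwrite_eq_iff c x b b Finset.univ).2
          ⟨fun i _ hi => hQ x b hb i hi, fun _ _ => rfl⟩
        exact funext fun i => this i (Finset.mem_univ i)
      rw [this]
  simp [reported, h]

/-- Local Friendliness behaviours are the mixtures of behaviours that satisfy Local Agency and
in which the outcomes of the queried friends are determined by the mixed variable. -/
theorem mem_localFriendliness_iff {p : S.Table} : p ∈ S.localFriendliness ↔ S.IsBehaviour p ∧
    ∃ (w : S.FriendOutcomes → ℝ) (Q : S.FriendOutcomes → S.Table),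
      (∀ c, 0 ≤ w c) ∧ ∑ c, w c = 1 ∧ (∀ c, S.IsBehaviour (Q c)) ∧ (∀ c, S.LocalAgency (Q c)) ∧
      (∀ c x a, Q c x a ≠ 0 → ∀ i : S.friends, x i.1 = S.query i.1 → (a i.1 : ℕ) = c i) ∧
      p = fun x a => ∑ c, Q c x a * w c := by
  constructor
  · rintro ⟨hp, w, P, hw, hw1, hP, hL, h⟩
    refine ⟨hp, w, fun c => reported (P c) c, hw, hw1, fun c => isBehaviour_reported (hP c) c,
      fun c => localAgency_reported (hL c) c, ?_, ?_⟩
    · intro c x a ha i hi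
      beta_reduce at ha
      rw [reported_eq] at ha
      have := Finset.prod_ne_zero_iff.1 (left_ne_zero_of_mul ha) i (by simp [queried, hi])
      by_contra hne
      simp [hne] at this
    · funext x a
      simp only [reported_eq, h]
  · rintro ⟨hp, w, Q, hw, hw1, hQ, hL, hd, h⟩
    refine ⟨hp, w, Q, hw, hw1, hQ, hL, fun x a => ?_⟩
    simp only [← reported_eq, h, eq_reported_self (hd _)]

theorem localFriendliness_subset_noSignalling : S.localFriendliness ⊆ S.noSignalling := by
  intro p hp
  obtain ⟨hb, w, Q, -, -, -, hL, -, rfl⟩ := mem_localFriendliness_iff.1 hp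
  refine ⟨hb, fun i x x' a a' hx ha => ?_⟩
  rw [marginal_sum, marginal_sum]
  exact Finset.sum_congr rfl fun c _ => by rw [hL c _ x x' a a' hx ha]

theorem noSignalling_subset_localFriendliness (h : S.friends = ∅) :
    S.noSignalling ⊆ S.localFriendliness := by
  intro p hp
  have : IsEmpty S.friends := by rw [h]; infer_instance
  refine mem_localFriendliness_iff.2 ⟨hp.1, fun _ => 1, fun _ => p, fun _ => zero_le_one, by simp,
    fun _ => hp.1, fun _ => localAgency_of_noSignalling hp, fun _ _ _ _ i => isEmptyElim i, ?_⟩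
  funext x a
  simp

end LFScenario

namespace LFScenario

variable {S : LFScenario}

/-! ## Popescu–Rohrlich boxes -/

/-- The outcomes of a Popescu–Rohrlich box with shared coin `r` between the measurements
`s₀, s₁` of party `j` and `t₀, t₁` of party `k`. All other outcomes are `0`. -/
def prOutcome (j k : Fin S.N) (s₀ s₁ : Fin (S.numMeas j)) (t₀ t₁ : Fin (S.numMeas k))
    (x : S.Inputs) (r : Fin 2) : S.Outputs x := fun i =>
  Fin.castLE (S.two_le_numOut i (x i)) <|
    if i = j then if x j = s₀ ∨ x j = s₁ then r else 0
    else if i = k then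
      if x k = t₀ ∨ x k = t₁ then if x j = s₁ ∧ x k = t₁ then r + 1 else r else 0
    else 0

/-- The Popescu–Rohrlich box between two measurements each of the parties `j` and `k`. -/
noncomputable def prBox (j k : Fin S.N) (s₀ s₁ : Fin (S.numMeas j)) (t₀ t₁ : Fin (S.numMeas k)) : S.Table :=
  fun x a => ∑ r, if prOutcome j k s₀ s₁ t₀ t₁ x r = a then 1 / 2 else 0

section

variable {j k : Fin S.N} {s₀ s₁ : Fin (S.numMeas j)} {t₀ t₁ : Fin (S.numMeas k)}

theorem isBehaviour_prBox : S.IsBehaviour (prBox j k s₀ s₁ t₀ t₁) := by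
  refine ⟨fun x a => Finset.sum_nonneg fun r _ => ?_, fun x => ?_⟩
  · split_ifs <;> norm_num
  · simp only [prBox]
    rw [Finset.sum_comm]
    simp

theorem marginal_prBox (V : Finset (Fin S.N)) (x : S.Inputs) (a : S.Outputs x) :
    S.marginal (prBox j k s₀ s₁ t₀ t₁) V x a =
      ∑ r, if ∀ i ∈ V, (prOutcome j k s₀ s₁ t₀ t₁ x r i : ℕ) = a i then 1 / 2 else 0 := by
  simp only [marginal, prBox]
  simp_rw [← Finset.sum_filter (p := fun a' : S.Outputs x => ∀ i ∈ V, a' i = a i)]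
  rw [Finset.sum_comm]
  refine Finset.sum_congr rfl fun b _ => ?_
  rw [Finset.sum_ite_eq]
  simp [Fin.ext_iff]

/-- A relabelling `σ` of the coin matches the outcomes on `V` in the two contexts. The flip is
needed only when `V` misses `j` and the special pair of settings occurs in exactly one of them; then
at most the outcome of `k` is visible, and it is uniform or constant. -/
theorem localAgency_prBox (hjk : j ≠ k) : S.LocalAgency (prBox j k s₀ s₁ t₀ t₁) := by
  intro V x x' a a' hx ha
  rw [marginal_prBox, marginal_prBox]
  suffices h : ∃ σ : Equiv.Perm (Fin 2), ∀ r, ∀ i ∈ V,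
      (prOutcome j k s₀ s₁ t₀ t₁ x r i : ℕ) = prOutcome j k s₀ s₁ t₀ t₁ x' (σ r) i by
    obtain ⟨σ, h⟩ := h
    refine Fintype.sum_equiv σ _ _ fun r => ?_
    have : (∀ i ∈ V, (prOutcome j k s₀ s₁ t₀ t₁ x r i : ℕ) = a i) ↔
        ∀ i ∈ V, (prOutcome j k s₀ s₁ t₀ t₁ x' (σ r) i : ℕ) = a' i :=
      forall₂_congr fun i hi => by rw [h r i hi, ha i hi]
    simp only [this]
  by_cases hj : j ∈ V
  · refine ⟨1, fun r i hi => ?_⟩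
    have h1 := hx j hj
    by_cases hij : i = j
    · subst hij; simp [prOutcome, h1]
    · by_cases hik : i = k
      · subst hik; simp [prOutcome, hij, h1, hx i hi]
      · simp [prOutcome, hij, hik]
  · by_cases hx1 : (x j = s₁ ∧ x k = t₁) ↔ (x' j = s₁ ∧ x' k = t₁)
    · refine ⟨1, fun r i hi => ?_⟩
      have hij : i ≠ j := by rintro rfl; exact hj hi
      by_cases hik : i = k
      · subst hik
        rw [hx i hi] at hx1
        simp only [prOutcome, hij, if_false, if_true, hx i hi, Fin.val_castLE,
          Equiv.Perm.one_apply, hx1]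
      · simp [prOutcome, hij, hik]
    · refine ⟨Equiv.addRight 1, fun r i hi => ?_⟩
      have hij : i ≠ j := by rintro rfl; exact hj hi
      by_cases hik : i = k
      · subst hik
        have h2 : ∀ r : Fin 2, r + 1 + 1 = r := by decide
        simp only [prOutcome, hij, if_false, if_true, hx i hi, Fin.val_castLE,
          Equiv.coe_addRight]
        rw [hx i hi] at hx1
        by_cases hA : x j = s₁ ∧ x' i = t₁ <;> by_cases hB : x' j = s₁ ∧ x' i = t₁
        · exact absurd (iff_of_true hA hB) hx1
        · rw [if_pos hA, if_neg hB]
        · rw [if_neg hA, if_pos hB, h2]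
        · exact absurd (iff_of_false hA hB) hx1
      · simp [prOutcome, hij, hik]

/-- The box is active only at measurements that are not queries of friends. Every queried friend
therefore reports `0`, and the point mass at the zero string `c₀` is a suitable weight. -/
theorem prBox_mem_localFriendliness (hjk : j ≠ k)
    (hs : j ∈ S.friends → s₀ ≠ S.query j ∧ s₁ ≠ S.query j)
    (ht : k ∈ S.friends → t₀ ≠ S.query k ∧ t₁ ≠ S.query k) :
    prBox j k s₀ s₁ t₀ t₁ ∈ S.localFriendliness := by
  classical
  let c₀ : S.FriendOutcomes := fun i => ⟨0, lt_of_lt_of_le Nat.zero_lt_two (S.two_le_numOut _ _)⟩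
  have hd : ∀ x a, prBox j k s₀ s₁ t₀ t₁ x a ≠ 0 →
      ∀ i : S.friends, x i.1 = S.query i.1 → (a i.1 : ℕ) = 0 := by
    intro x a ha i hi
    obtain ⟨r, -, hr⟩ := Finset.exists_ne_zero_of_sum_ne_zero ha
    obtain rfl : prOutcome j k s₀ s₁ t₀ t₁ x r = a := by
      by_contra h
      exact hr (if_neg h)
    obtain ⟨i, hf⟩ := i
    dsimp only at hi ⊢
    by_cases hij : i = j
    · subst hij
      simp [prOutcome, hi, (hs hf).1.symm, (hs hf).2.symm]
    · by_cases hik : i = k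
      · subst hik
        simp [prOutcome, hij, hi, (ht hf).1.symm, (ht hf).2.symm]
      · simp [prOutcome, hij, hik]
  refine ⟨isBehaviour_prBox, Pi.single c₀ 1, fun _ => prBox j k s₀ s₁ t₀ t₁, fun c => ?_, ?_,
    fun _ => isBehaviour_prBox, fun _ => localAgency_prBox hjk, fun x a => ?_⟩
  · by_cases h : c = c₀
    · subst h; simp
    · simp [h]
  · simp
  · rw [Finset.sum_eq_single c₀ (fun c _ hc => by simp [hc]) (by simp), ← reported_eq,
      eq_reported_self hd]
    simp

end

end LFScenario

/-! ## Traces and tensor product operators -/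

section HilbertSpace

variable {K : Type} [NormedAddCommGroup K] [InnerProductSpace ℂ K]

theorem hasTrace_sum {ι : Type*} (s : Finset ι) {A : ι → K →L[ℂ] K} {c : ι → ℂ}
    (h : ∀ i ∈ s, HasTrace (A i) (c i)) : HasTrace (∑ i ∈ s, A i) (∑ i ∈ s, c i) := by
  intro t b
  simp only [sum_apply, inner_sum]
  exact hasSum_sum fun i hi => h i hi t b

theorem HilbertBasis.hasSum_norm_inner_sq {ι : Type*} (b : HilbertBasis ι ℂ K) (x : K) :
    HasSum (fun i => ‖⟪b i, x⟫_ℂ‖ ^ 2) (‖x‖ ^ 2) := by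
  have h := Complex.hasSum_re (b.hasSum_inner_mul_inner x x)
  have h2 : ∀ i, (⟪x, b i⟫_ℂ * ⟪b i, x⟫_ℂ).re = ‖⟪b i, x⟫_ℂ‖ ^ 2 := fun i => by
    rw [← inner_conj_symm x (b i), RCLike.conj_mul]
    norm_cast
  have h3 : (⟪x, x⟫_ℂ).re = ‖x‖ ^ 2 := inner_self_eq_norm_sq (𝕜 := ℂ) x
  simpa only [h2, h3] using h

/-- The Hilbert–Schmidt estimate: by Parseval each family of coefficients is square summable over
the pairs, and a product is bounded by the sum of the squares. -/
theorem HilbertBasis.summable_inner_mul_inner_of_sq {ι κ : Type*} (b : HilbertBasis κ ℂ K)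
    {g h : ι → K} (hg : Summable fun k => ‖g k‖ ^ 2) (hh : Summable fun k => ‖h k‖ ^ 2) :
    Summable fun q : ι × κ => ⟪g q.1, b q.2⟫_ℂ * ⟪b q.2, h q.1⟫_ℂ := by
  have hsum : ∀ g : ι → K, (Summable fun k => ‖g k‖ ^ 2) →
      Summable fun q : ι × κ => ‖⟪b q.2, g q.1⟫_ℂ‖ ^ 2 := fun g hg => by
    refine (summable_prod_of_nonneg fun q => by positivity).2
      ⟨fun k => (b.hasSum_norm_inner_sq (g k)).summable, ?_⟩
    simpa only [(b.hasSum_norm_inner_sq (g _)).tsum_eq] using hg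
  refine Summable.of_norm_bounded ((hsum _ hg).add (hsum _ hh)) fun q => ?_
  rw [norm_mul, norm_inner_symm]
  have h0 := two_mul_le_add_sq ‖⟪b q.2, g q.1⟫_ℂ‖ ‖⟪b q.2, h q.1⟫_ℂ‖
  have h1 := mul_nonneg (norm_nonneg ⟪b q.2, g q.1⟫_ℂ) (norm_nonneg ⟪b q.2, h q.1⟫_ℂ)
  linarith

/-- The cyclicity of the trace for the square root of a trace class operator. -/
theorem hasSum_inner_of_hasTrace_mul {T R : K →L[ℂ] K} (hT : T.IsPositive) (hR : R.IsPositive)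
    {c d : ℂ} (hc : HasTrace (R * R) c) (hd : HasTrace (T * (R * R)) d) {s : Set K}
    (b : HilbertBasis s ℂ K) : HasSum (fun k => ⟪R (b k), T (R (b k))⟫_ℂ) d := by
  have hRs : Summable fun k => ‖R (b k)‖ ^ 2 := by
    have h := hc s b
    have h2 : ∀ k, (⟪b k, (R * R) (b k)⟫_ℂ).re = ‖R (b k)‖ ^ 2 := fun k => by
      rw [mul_apply_eq_comp, ← hR.inner_left_eq_inner_right]
      exact inner_self_eq_norm_sq (𝕜 := ℂ) _
    simpa only [h2] using (Complex.hasSum_re h).summable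
  have hTs : Summable fun k => ‖T (R (b k))‖ ^ 2 := by
    refine Summable.of_nonneg_of_le (fun k => by positivity) (fun k => ?_)
      (hRs.mul_left (‖T‖ ^ 2))
    rw [← mul_pow]
    exact pow_le_pow_left₀ (norm_nonneg _) (T.le_opNorm _) 2
  -- This double series converges absolutely. Summing it in one order gives the claimed sum, in the
  -- other order the diagonal sum of `T * (R * R)`.
  have hf := b.summable_inner_mul_inner_of_sq hRs hTs
  have h1 := hf.hasSum.prod_fiberwise (g := fun k => ⟪R (b k), T (R (b k))⟫_ℂ)
    fun k => b.hasSum_inner_mul_inner (R (b k)) (T (R (b k)))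
  have h3 : ∀ k l, ⟪R (b l), b k⟫_ℂ * ⟪b k, T (R (b l))⟫_ℂ =
      ⟪R (T (b k)), b l⟫_ℂ * ⟪b l, R (b k)⟫_ℂ := fun k l => by
    rw [hR.inner_left_eq_inner_right, hR.inner_left_eq_inner_right, hT.inner_left_eq_inner_right,
      mul_comm]
  have h4 : ∀ k, ⟪R (T (b k)), R (b k)⟫_ℂ = ⟪b k, (T * (R * R)) (b k)⟫_ℂ := fun k => by
    rw [hR.inner_left_eq_inner_right, hT.inner_left_eq_inner_right]
    rfl
  have h2 := ((Equiv.prodComm s s).hasSum_iff.2 hf.hasSum).prod_fiberwise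
    (g := fun k => ⟪b k, (T * (R * R)) (b k)⟫_ℂ) fun k => by
      have h5 := b.hasSum_inner_mul_inner (R (T (b k))) (R (b k))
      simp only [← h3, h4] at h5
      exact h5
  rwa [h2.unique (hd s b)] at h1

variable [CompleteSpace K]

theorem HasTrace.unique {A : K →L[ℂ] K} {c d : ℂ} (hc : HasTrace A c) (hd : HasTrace A d) :
    c = d := by
  obtain ⟨s, b, -⟩ := exists_hilbertBasis ℂ K
  exact (hc s b).unique (hd s b)

theorem ContinuousLinearMap.IsPositive.exists_mul_self {T : K →L[ℂ] K} (hT : T.IsPositive) :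
    ∃ R : K →L[ℂ] K, R.IsPositive ∧ R * R = T := by
  have h0 : 0 ≤ T := (ContinuousLinearMap.nonneg_iff_isPositive T).2 hT
  exact ⟨CFC.sqrt T, (ContinuousLinearMap.nonneg_iff_isPositive _).1 (CFC.sqrt_nonneg T),
    CFC.sqrt_mul_sqrt_self T h0⟩

theorem ContinuousLinearMap.IsPositive.apply_eq_zero {T : K →L[ℂ] K} (hT : T.IsPositive) {x : K}
    (h : ⟪x, T x⟫_ℂ = 0) : T x = 0 := by
  obtain ⟨R, hR, rfl⟩ := hT.exists_mul_self
  have h1 : ⟪R x, R x⟫_ℂ = 0 := by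
    rw [hR.inner_left_eq_inner_right]
    exact h
  rw [mul_apply_eq_comp, inner_self_eq_zero.1 h1, map_zero]

/-- With ρ = R², the trace is a sum of the nonnegative terms ⟪R bₖ, T R bₖ⟫. All of them vanish, so
positivity of `T` gives T R bₖ = 0 for every k. -/
theorem eq_zero_of_hasTrace_eq_zero {T ρ : K →L[ℂ] K} (hT : T.IsPositive) (hρ : ρ.IsPositive)
    {c : ℂ} (hc : HasTrace ρ c) (h : HasTrace (T * ρ) 0) : T * ρ = 0 := by
  obtain ⟨R, hR, rfl⟩ := hρ.exists_mul_self
  obtain ⟨s, b, -⟩ := exists_hilbertBasis ℂ K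
  have h1 := hasSum_inner_of_hasTrace_mul hT hR hc h b
  have h2 : ∀ k, ⟪R (b k), T (R (b k))⟫_ℂ = 0 := by
    have h3 : HasSum (fun k => (⟪R (b k), T (R (b k))⟫_ℂ).re) 0 := by
      simpa using Complex.hasSum_re h1
    have h4 := (hasSum_zero_iff_of_nonneg fun k => hT.re_inner_nonneg_right (R (b k))).1 h3
    intro k
    refine Complex.ext (congrFun h4 k) ?_
    exact ((Complex.le_def.1 (hT.inner_nonneg_right (R (b k)))).2).symm
  have h5 : T * R = 0 := by
    have hd : Dense (Submodule.span ℂ (Set.range b) : Set K) := by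
      rw [Submodule.dense_iff_topologicalClosure_eq_top]
      exact b.dense_span
    refine ContinuousLinearMap.ext_on hd ?_
    rintro _ ⟨k, rfl⟩
    exact hT.apply_eq_zero (h2 k)
  rw [← mul_assoc, h5, zero_mul]

end HilbertSpace

section TensorOperator

variable {ι : Type} [Fintype ι] {H : ι → Type} [∀ i, NormedAddCommGroup (H i)]
  [∀ i, InnerProductSpace ℂ (H i)] [∀ i, CompleteSpace (H i)]
  {K : Type} [NormedAddCommGroup K] [InnerProductSpace ℂ K] [CompleteSpace K]
  {t : MultilinearMap ℂ H K} (ht : IsHilbertTensorProduct t)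

theorem tensorOperator_mul (A B : (i : ι) → H i →L[ℂ] H i) :
    tensorOperator ht A * tensorOperator ht B = tensorOperator ht fun i => A i * B i := by
  refine ht.operator_unique (A := fun i => A i * B i) (fun u => ?_) (tensorOperator_spec ht _)
  rw [mul_apply_eq_comp, tensorOperator_spec ht B u, tensorOperator_spec ht A]
  rfl

theorem sum_tensorOperator [DecidableEq ι] {κ : ι → Type*} (C : (i : ι) → Finset (κ i))
    (A : (i : ι) → κ i → H i →L[ℂ] H i) :
    ∑ r ∈ Fintype.piFinset C, tensorOperator ht (fun i => A i (r i)) =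
      tensorOperator ht fun i => ∑ c ∈ C i, A i c := by
  refine ht.operator_unique (A := fun i => ∑ c ∈ C i, A i c) (fun u => ?_)
    (tensorOperator_spec ht _)
  rw [sum_apply]
  simp only [sum_apply]
  rw [t.map_sum_finset]
  exact Finset.sum_congr rfl fun r _ => tensorOperator_spec ht _ u

/-- The tensor product of the square roots is self-adjoint, as is checked on product vectors, and
its square is the given operator. -/
theorem isPositive_tensorOperator {A : (i : ι) → H i →L[ℂ] H i} (hA : ∀ i, (A i).IsPositive) :
    (tensorOperator ht A).IsPositive := by
  choose R hR hRA using fun i => (hA i).exists_mul_self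
  obtain rfl : (fun i => R i * R i) = A := funext hRA
  rw [← tensorOperator_mul]
  have hadj : ContinuousLinearMap.adjoint (tensorOperator ht R) = tensorOperator ht R := by
    refine ContinuousLinearMap.ext_on ht.dense_span ?_
    rintro _ ⟨u, rfl⟩
    refine ht.dense_span.eq_of_inner_right ℂ ?_
    intro v hv
    induction hv using Submodule.span_induction with
    | mem v hv =>
      obtain ⟨v, rfl⟩ := hv
      rw [ContinuousLinearMap.adjoint_inner_right, tensorOperator_spec ht R,
        tensorOperator_spec ht R, ht.inner_tprod, ht.inner_tprod]
      exact Finset.prod_congr rfl fun i _ => (hR i).inner_left_eq_inner_right _ _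
    | zero => simp
    | add v w _ _ hv hw => rw [inner_add_left, inner_add_left, hv, hw]
    | smul c v _ hv => rw [inner_smul_left, inner_smul_left, hv]
  have := ContinuousLinearMap.isPositive_adjoint_comp_self (tensorOperator ht R)
  rwa [hadj] at this

variable [DecidableEq ι]

/-- The operator that acts as `A` on the tensor factor `j`. -/
noncomputable def localOperator (j : ι) (A : H j →L[ℂ] H j) : K →L[ℂ] K :=
  tensorOperator ht (Function.update (fun i => ContinuousLinearMap.id ℂ (H i)) j A)

theorem localOperator_apply (j : ι) (A : H j →L[ℂ] H j) (u : (i : ι) → H i) :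
    localOperator ht j A (t u) = t (Function.update u j (A (u j))) := by
  rw [localOperator, tensorOperator_spec ht _ u]
  congr 1
  funext i
  by_cases h : i = j
  · subst h; simp
  · simp [h]

theorem localOperator_id (j : ι) : localOperator ht j (ContinuousLinearMap.id ℂ (H j)) = 1 := by
  refine ContinuousLinearMap.ext_on ht.dense_span ?_
  rintro _ ⟨u, rfl⟩
  rw [localOperator_apply]
  simp

theorem localOperator_add (j : ι) (A B : H j →L[ℂ] H j) :
    localOperator ht j (A + B) = localOperator ht j A + localOperator ht j B := by
  refine ContinuousLinearMap.ext_on ht.dense_span ?_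
  rintro _ ⟨u, rfl⟩
  simp only [add_apply, localOperator_apply, MultilinearMap.map_update_add]

theorem localOperator_mul_localOperator {j k : ι} (hjk : j ≠ k) (A : H j →L[ℂ] H j)
    (B : H k →L[ℂ] H k) : localOperator ht j A * localOperator ht k B =
      tensorOperator ht (Function.update (Function.update
        (fun i => ContinuousLinearMap.id ℂ (H i)) j A) k B) := by
  rw [localOperator, localOperator, tensorOperator_mul]
  congr 1
  funext i
  by_cases hk : i = k
  · subst hk
    simp only [Function.update_self, Function.update_of_ne hjk.symm]
    rfl
  · by_cases hj : i = j
    · subst hj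
      simp only [Function.update_self, Function.update_of_ne hk]
      rfl
    · simp only [Function.update_of_ne hk, Function.update_of_ne hj]
      rfl

end TensorOperator

namespace LFScenario

variable {S : LFScenario}

/-! ## Quantum behaviours are no-signalling -/

theorem QuantumModel.povm_congr (m : S.QuantumModel) {i : Fin S.N} {s s' : Fin (S.numMeas i)}
    (h : s = s') {c : Fin (S.numOut i s)} {c' : Fin (S.numOut i s')} (hc : (c : ℕ) = c') :
    m.povm i s c = m.povm i s' c' := by
  subst h
  rw [Fin.ext hc]

/-- The Born rule for product events. It yields the marginals for the no-signalling property and the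
binning of outcomes into zero and nonzero. -/
theorem QuantumModel.hasTrace_sum {m : S.QuantumModel} {p : S.Table}
    (hm : ∀ x a, HasTrace (tensorOperator m.isTensor (fun i => m.povm i (x i) (a i)) ∘L m.state)
      ((p x a : ℝ) : ℂ)) (x : S.Inputs) (C : (i : Fin S.N) → Finset (Fin (S.numOut i (x i)))) :
    HasTrace (tensorOperator m.isTensor (fun i => ∑ c ∈ C i, m.povm i (x i) c) * m.state)
      ((∑ a ∈ Fintype.piFinset C, p x a : ℝ) : ℂ) := by
  rw [← sum_tensorOperator, Finset.sum_mul, Complex.ofReal_sum]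
  exact _root_.hasTrace_sum _ fun a _ => hm x a

/-- Summing over the outcomes of `i` replaces its effect by the identity, and the resulting operator
no longer depends on the setting of `i`. -/
theorem quantum_subset_noSignalling : S.quantum ⊆ S.noSignalling := by
  rintro p ⟨hp, m, hm⟩
  refine ⟨hp, fun i x x' a a' hx ha => ?_⟩
  have key : ∀ (x : S.Inputs) (a : S.Outputs x),
      HasTrace (tensorOperator m.isTensor (Function.update (fun l => m.povm l (x l) (a l)) i
        (ContinuousLinearMap.id ℂ (m.H i))) * m.state)
        ((S.marginal p (Finset.univ.erase i) x a : ℝ) : ℂ) := by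
    intro x a
    have h := m.hasTrace_sum hm x
      (Function.update (fun l => ({a l} : Finset (Fin (S.numOut l (x l))))) i Finset.univ)
    have h1 : (fun l => ∑ c ∈ Function.update
        (fun l => ({a l} : Finset (Fin (S.numOut l (x l))))) i Finset.univ l, m.povm l (x l) c) =
        Function.update (fun l => m.povm l (x l) (a l)) i (ContinuousLinearMap.id ℂ (m.H i)) := by
      funext l
      by_cases hl : l = i
      · subst hl
        simp [m.povm_sum]
      · simp [hl]
    have h2 : ∑ b ∈ Fintype.piFinset (Function.update
        (fun l => ({a l} : Finset (Fin (S.numOut l (x l))))) i Finset.univ), p x b =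
        S.marginal p (Finset.univ.erase i) x a := by
      rw [marginal, ← Finset.sum_filter]
      refine Finset.sum_congr ?_ fun _ _ => rfl
      ext b
      simp only [Fintype.mem_piFinset, Finset.mem_filter, Finset.mem_univ, true_and,
        Finset.mem_erase, and_true]
      refine forall_congr' fun l => ?_
      by_cases hl : l = i
      · subst hl; simp
      · simp [hl]
    rwa [h1, h2] at h
  have h1 := key x a
  have h2 := key x' a'
  have h3 : Function.update (fun l => m.povm l (x l) (a l)) i (ContinuousLinearMap.id ℂ (m.H i)) =
      Function.update (fun l => m.povm l (x' l) (a' l)) i (ContinuousLinearMap.id ℂ (m.H i)) := by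
    funext l
    by_cases hl : l = i
    · subst hl; simp
    · simp only [Function.update_of_ne hl]
      exact m.povm_congr (hx l (by simp [hl])) (ha l (by simp [hl]))
  rw [h3] at h1
  exact_mod_cast h1.unique h2

/-! ## Popescu–Rohrlich boxes are not quantum -/

/-- The effect that tests whether the outcome of measurement `s` of party `i` is `0` (for
`e = true`) or different from `0` (for `e = false`). -/
noncomputable def QuantumModel.zeroEffect (m : S.QuantumModel) (i : Fin S.N) (e : Bool)
    (s : Fin (S.numMeas i)) : m.H i →L[ℂ] m.H i :=
  ∑ c ∈ Finset.univ.filter fun c : Fin (S.numOut i s) => decide ((c : ℕ) = 0) = e, m.povm i s c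

theorem QuantumModel.localOperator_zeroEffect_add (m : S.QuantumModel) (i : Fin S.N)
    (s : Fin (S.numMeas i)) : localOperator m.isTensor i (m.zeroEffect i true s) +
      localOperator m.isTensor i (m.zeroEffect i false s) = 1 := by
  rw [← localOperator_add, ← localOperator_id m.isTensor i, ← m.povm_sum i s]
  congr 1
  simp only [zeroEffect, decide_eq_true_eq, decide_eq_false_iff_not]
  exact Finset.sum_filter_add_sum_filter_not _ (fun c : Fin (S.numOut i s) => (c : ℕ) = 0) _

/-- The hypothesis says that the binned event has probability zero, so its effect, a positive
operator, annihilates the state. -/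
theorem QuantumModel.mul_state_eq_zero {m : S.QuantumModel} {p : S.Table}
    (hm : ∀ x a, HasTrace (tensorOperator m.isTensor (fun i => m.povm i (x i) (a i)) ∘L m.state)
      ((p x a : ℝ) : ℂ)) {j k : Fin S.N} (hjk : j ≠ k) (x : S.Inputs) (e f : Bool)
    (h : ∀ a, decide ((a j : ℕ) = 0) = e → decide ((a k : ℕ) = 0) = f → p x a = 0) :
    localOperator m.isTensor j (m.zeroEffect j e (x j)) *
      (localOperator m.isTensor k (m.zeroEffect k f (x k)) * m.state) = 0 := by
  rw [← mul_assoc, localOperator_mul_localOperator _ hjk]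
  let C : (i : Fin S.N) → Finset (Fin (S.numOut i (x i))) := fun i =>
    {c | (i = j → decide ((c : ℕ) = 0) = e) ∧ (i = k → decide ((c : ℕ) = 0) = f)}
  have hC : (fun i => ∑ c ∈ C i, m.povm i (x i) c) = Function.update (Function.update
      (fun i => ContinuousLinearMap.id ℂ (m.H i)) j (m.zeroEffect j e (x j))) k
        (m.zeroEffect k f (x k)) := by
    funext i
    by_cases hk : i = k
    · subst hk
      simp [C, hjk.symm, zeroEffect]
    · by_cases hj : i = j
      · subst hj
        simp [C, hk, zeroEffect]
      · simp [C, hk, hj, m.povm_sum]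
  have htr := m.hasTrace_sum hm x C
  rw [Finset.sum_eq_zero fun a ha => ?_] at htr
  · rw [← hC]
    refine eq_zero_of_hasTrace_eq_zero (isPositive_tensorOperator _ fun i => ?_) m.state_pos
      m.state_trace (by simpa using htr)
    exact ContinuousLinearMap.isPositive_sum _ fun c _ => m.povm_pos i (x i) c
  · simp only [Fintype.mem_piFinset, C, Finset.mem_filter, Finset.mem_univ, true_and] at ha
    exact h a ((ha j).1 rfl) ((ha k).2 rfl)

/-- Let αₛ, βₜ be the local effects for the outcome zero and ρ the state. Perfect correlation gives
αₛρ = βₜρ for three of the pairs of settings; perfect anticorrelation for the fourth pair then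
forces ρ = 0. -/
theorem prBox_notMem_quantum {j k : Fin S.N} (hjk : j ≠ k) {s₀ s₁ : Fin (S.numMeas j)}
    (hs : s₀ ≠ s₁) {t₀ t₁ : Fin (S.numMeas k)} (ht : t₀ ≠ t₁) :
    prBox j k s₀ s₁ t₀ t₁ ∉ S.quantum := by
  rintro ⟨-, m, hm⟩
  let x : Fin (S.numMeas j) → Fin (S.numMeas k) → S.Inputs := fun s t =>
    Function.update (Function.update S.query j s) k t
  have hxj : ∀ s t, x s t j = s := fun s t => by simp [x, hjk]
  have hxk : ∀ s t, x s t k = t := fun s t => by simp [x]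
  have hsupp : ∀ s t (a : S.Outputs (x s t)), prBox j k s₀ s₁ t₀ t₁ (x s t) a ≠ 0 →
      (s = s₀ ∨ s = s₁) → (t = t₀ ∨ t = t₁) →
      (decide ((a j : ℕ) = 0) = decide ((a k : ℕ) = 0) ↔ ¬ (s = s₁ ∧ t = t₁)) := by
    intro s t a ha hs ht
    obtain ⟨r, -, hr⟩ := Finset.exists_ne_zero_of_sum_ne_zero ha
    obtain rfl : prOutcome j k s₀ s₁ t₀ t₁ (x s t) r = a := by
      by_contra h
      exact hr (if_neg h)
    simp only [prOutcome, Fin.val_castLE, hjk.symm, if_true, if_false, hxj, hxk, hs, ht]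
    by_cases h : s = s₁ ∧ t = t₁
    · rw [if_pos h]
      simp only [h]
      fin_cases r <;> simp
    · rw [if_neg h]
      simp [h]
  let α : Bool → Fin (S.numMeas j) → m.K →L[ℂ] m.K := fun e s =>
    localOperator m.isTensor j (m.zeroEffect j e s)
  let β : Bool → Fin (S.numMeas k) → m.K →L[ℂ] m.K := fun e t =>
    localOperator m.isTensor k (m.zeroEffect k e t)
  have hα : ∀ s, α true s + α false s = 1 := m.localOperator_zeroEffect_add j
  have hβ : ∀ t, β true t + β false t = 1 := m.localOperator_zeroEffect_add k
  have hzero : ∀ s t e f, (s = s₀ ∨ s = s₁) → (t = t₀ ∨ t = t₁) →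
      (e = f ↔ s = s₁ ∧ t = t₁) → α e s * (β f t * m.state) = 0 := by
    intro s t e f hs ht he
    have h := m.mul_state_eq_zero hm hjk (x s t) e f fun a hae hbf => by
      by_contra hne
      have := hsupp s t a hne hs ht
      rw [hae, hbf] at this
      tauto
    rwa [hxj, hxk] at h
  have heq : ∀ s t, (s = s₀ ∨ s = s₁) → (t = t₀ ∨ t = t₁) → ¬ (s = s₁ ∧ t = t₁) →
      α true s * m.state = β true t * m.state := by
    intro s t hs ht hst
    have h1 := hzero s t true false hs ht (by simp [hst])
    have h2 := hzero s t false true hs ht (by simp [hst])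
    rw [eq_sub_iff_add_eq'.2 (hβ t), sub_mul, one_mul, mul_sub, sub_eq_zero] at h1
    rw [eq_sub_iff_add_eq'.2 (hα s), sub_mul, one_mul, sub_eq_zero] at h2
    rw [h1, ← h2]
  have h00 := heq s₀ t₀ (.inl rfl) (.inl rfl) (by simp [hs])
  have h01 := heq s₀ t₁ (.inl rfl) (.inr rfl) (by simp [hs])
  have h10 := heq s₁ t₀ (.inr rfl) (.inl rfl) (by simp [ht])
  have h11 := hzero s₁ t₁ true true (.inr rfl) (.inr rfl) (by simp)
  have h11' := hzero s₁ t₁ false false (.inr rfl) (.inr rfl) (by simp)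
  -- Expanding (1 - α₁)(1 - β₁)ρ = 0 with α₁β₁ρ = 0 gives ρ = β₁ρ + α₁ρ, and the three equalities
  -- turn this into ρ = α₀ρ + α₀ρ.
  rw [eq_sub_iff_add_eq'.2 (hα s₁), eq_sub_iff_add_eq'.2 (hβ t₁), sub_mul, one_mul, sub_mul,
    one_mul, mul_sub, h11, sub_zero, sub_sub, sub_eq_zero] at h11'
  rw [h10, ← h00, ← h01] at h11'
  -- Apply α₁ to ρ = 2α₀ρ = 2β₁ρ. Then ρ = 2β₀ρ = 2α₁ρ vanishes too.
  have h5 : α true s₁ * m.state = 0 := by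
    conv_lhs => rw [h11', h01, mul_add, h11, add_zero]
  have h6 : m.state = 0 := by
    rw [h11', h00, ← h10, h5, add_zero]
  have h7 := m.state_trace
  rw [h6] at h7
  refine zero_ne_one (α := ℂ) (HasTrace.unique (A := (0 : m.K →L[ℂ] m.K)) (fun s b => ?_) h7)
  simp

end LFScenario

namespace LFScenario

variable {S : LFScenario}

/-! ## Pure state models -/

theorem hasTrace_mul_rankOne {K : Type} [NormedAddCommGroup K] [InnerProductSpace ℂ K]
    (T : K →L[ℂ] K) (ψ : K) :
    HasTrace (T ∘L InnerProductSpace.rankOne ℂ ψ ψ) ⟪ψ, T ψ⟫_ℂ := by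
  intro s b
  refine (b.hasSum_inner_mul_inner ψ (T ψ)).congr_fun fun k => ?_
  simp

/-- A pure state (not necessarily normalised) and measurements on the factors of a tensor product
yield a quantum behaviour. -/
theorem exists_mem_quantum_of_vector {H : Fin S.N → Type} [∀ i, NormedAddCommGroup (H i)]
    [∀ i, InnerProductSpace ℂ (H i)] [∀ i, CompleteSpace (H i)] {K : Type} [NormedAddCommGroup K]
    [InnerProductSpace ℂ K] [CompleteSpace K] {t : MultilinearMap ℂ H K}
    (ht : IsHilbertTensorProduct t)
    (E : (i : Fin S.N) → (s : Fin (S.numMeas i)) → Fin (S.numOut i s) → H i →L[ℂ] H i)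
    (hE : ∀ i s c, (E i s c).IsPositive)
    (hE1 : ∀ i s, ∑ c, E i s c = ContinuousLinearMap.id ℂ (H i)) {ψ : K} (hψ : ψ ≠ 0) :
    ∃ p ∈ S.quantum, ∀ x a,
      p x a = 0 ↔ tensorOperator ht (fun i => E i (x i) (a i)) ψ = 0 := by
  let T : (x : S.Inputs) → S.Outputs x → K →L[ℂ] K := fun x a =>
    tensorOperator ht fun i => E i (x i) (a i)
  have hT : ∀ x a, (T x a).IsPositive := fun x a =>
    isPositive_tensorOperator ht fun i => hE i (x i) (a i)
  -- Normalising does not change which effects annihilate the vector, and the conclusion on zeros of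
  -- `p` concerns nothing else.
  let φ : K := ((‖ψ‖⁻¹ : ℝ) : ℂ) • ψ
  have hr : ((‖ψ‖⁻¹ : ℝ) : ℂ) ≠ 0 := by simpa using hψ
  have hφ : ⟪φ, φ⟫_ℂ = 1 := by
    have : ‖φ‖ = 1 := by simp [φ, norm_smul, hψ]
    simp [inner_self_eq_norm_sq_to_K, this]
  let p : S.Table := fun x a => (⟪φ, T x a φ⟫_ℂ).re
  have hp : ∀ x a, ((p x a : ℝ) : ℂ) = ⟪φ, T x a φ⟫_ℂ := fun x a =>
    Complex.ext rfl (Complex.le_def.1 ((hT x a).inner_nonneg_right φ)).2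
  refine ⟨p, ⟨⟨fun x a => (hT x a).re_inner_nonneg_right φ, fun x => ?_⟩, ?_⟩, fun x a => ?_⟩
  · have h1 : ∑ a, T x a = 1 := by
      have h := sum_tensorOperator ht (fun i => (Finset.univ : Finset (Fin (S.numOut i (x i)))))
        (fun i c => E i (x i) c)
      rw [Fintype.piFinset_univ] at h
      refine h.trans ?_
      refine ht.operator_unique (tensorOperator_spec ht _) fun u => ?_
      simp only [hE1]
      rfl
    have h2 : ((∑ a, p x a : ℝ) : ℂ) = 1 := by
      rw [Complex.ofReal_sum]
      simp only [hp]
      rw [← inner_sum, ← sum_apply, h1]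
      exact hφ
    exact_mod_cast h2
  · refine ⟨{ H := H, K := K, tprod := t, isTensor := ht, state := InnerProductSpace.rankOne ℂ φ φ,
              state_pos := InnerProductSpace.isPositive_rankOne_self φ, state_trace := ?_,
              povm := E, povm_pos := hE, povm_sum := hE1 }, fun x a => ?_⟩
    · have h := hasTrace_mul_rankOne (ContinuousLinearMap.id ℂ K) φ
      rw [ContinuousLinearMap.id_comp] at h
      rw [← hφ]
      exact h
    · rw [hp]
      exact hasTrace_mul_rankOne (T x a) φ
  · have h1 : p x a = 0 ↔ T x a φ = 0 := by
      rw [← Complex.ofReal_eq_zero, hp]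
      exact ⟨(hT x a).apply_eq_zero, fun h => by rw [h, inner_zero_right]⟩
    rw [h1]
    simp only [φ, map_smul, smul_eq_zero, hr, false_or]
    rfl

/-! ## Qubits -/

theorem prod_update_coordinate {ι κ : Type} [Fintype ι] [DecidableEq ι]
    (u : ι → EuclideanSpace ℂ κ) (i : ι) (v : EuclideanSpace ℂ κ) (f : ι → κ) :
    ∏ l, Function.update u i v l (f l) = v (f i) * ∏ l ∈ Finset.univ.erase i, u l (f l) := by
  rw [← Finset.mul_prod_erase _ _ (Finset.mem_univ i), Function.update_self]
  congr 1
  refine Finset.prod_congr rfl fun l hl => ?_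
  rw [Function.update_of_ne (Finset.ne_of_mem_erase hl)]

/-- The tensor product of vectors of finite-dimensional coordinate spaces. -/
noncomputable def coordinateTensor (ι κ : Type) [Fintype ι] [Fintype κ] :
    MultilinearMap ℂ (fun _ : ι => EuclideanSpace ℂ κ) (EuclideanSpace ℂ (ι → κ)) where
  toFun u := WithLp.toLp 2 fun f => ∏ i, u i (f i)
  map_update_add' u i v w := by
    ext f
    simp only [PiLp.add_apply, prod_update_coordinate, add_mul]
  map_update_smul' u i c v := by
    ext f
    simp only [PiLp.smul_apply, prod_update_coordinate, smul_eq_mul, mul_assoc]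

theorem isHilbertTensorProduct_coordinateTensor (ι κ : Type) [Fintype ι] [Fintype κ]
    [DecidableEq ι] [DecidableEq κ] : IsHilbertTensorProduct (coordinateTensor ι κ) where
  inner_tprod u v := by
    simp only [PiLp.inner_apply, Finset.prod_univ_sum, Fintype.piFinset_univ]
    refine Finset.sum_congr rfl fun f _ => ?_
    simp [coordinateTensor, Finset.prod_mul_distrib]
  dense_span := by
    have h : Submodule.span ℂ (Set.range (coordinateTensor ι κ)) = ⊤ := by
      rw [eq_top_iff, ← (EuclideanSpace.basisFun (ι → κ) ℂ).toBasis.span_eq]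
      refine Submodule.span_mono ?_
      rintro _ ⟨f, rfl⟩
      refine ⟨fun i => EuclideanSpace.single (f i) 1, ?_⟩
      ext g
      simp [coordinateTensor, Finset.prod_ite_zero, funext_iff, eq_comm]
    rw [h]
    exact dense_univ

/-- The measurement with the effect `P` for the outcome `0` and `1 - P` for the outcome `1`. -/
noncomputable def binaryEffect {V : Type} [NormedAddCommGroup V] [InnerProductSpace ℂ V] {n : ℕ}
    (P : V →L[ℂ] V) (c : Fin n) : V →L[ℂ] V :=
  if (c : ℕ) = 0 then P else if (c : ℕ) = 1 then 1 - P else 0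

section

variable {V : Type} [NormedAddCommGroup V] [InnerProductSpace ℂ V] {n : ℕ} {P : V →L[ℂ] V}

theorem sum_binaryEffect (hn : 2 ≤ n) :
    ∑ c : Fin n, binaryEffect P c = ContinuousLinearMap.id ℂ V := by
  obtain ⟨n, rfl⟩ := Nat.exists_eq_add_of_le' hn
  simp only [Fin.sum_univ_succ, binaryEffect, Fin.val_zero, Fin.val_succ]
  simp
  rfl

theorem isPositive_binaryEffect [CompleteSpace V] (hP : IsStarProjection P) (c : Fin n) :
    (binaryEffect P c).IsPositive := by
  unfold binaryEffect
  split_ifs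
  · exact (ContinuousLinearMap.nonneg_iff_isPositive _).1 hP.nonneg
  · exact (ContinuousLinearMap.nonneg_iff_isPositive _).1 hP.one_sub.nonneg
  · exact ContinuousLinearMap.isPositive_zero

theorem binaryEffect_apply_of_ne_zero {v : V} (hv : P v = v) {c : Fin n} (hc : (c : ℕ) ≠ 0) :
    binaryEffect P c v = 0 := by
  unfold binaryEffect
  rw [if_neg hc]
  split_ifs <;> simp [hv]

end

/-! ### Hardy's paradox -/

/-- A unit vector that has the same overlap with the two basis vectors. -/
noncomputable def diagonalQubit : EuclideanSpace ℂ (Fin 2) :=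
  !₂[((√2)⁻¹ : ℝ), ((√2)⁻¹ : ℝ)]

theorem norm_diagonalQubit : ‖diagonalQubit‖ = 1 := by
  rw [EuclideanSpace.norm_eq]
  simp [diagonalQubit, Fin.sum_univ_two]
  norm_num

/-- The unit vector that defines the outcome `0` of measurement `s` of party `i` in Hardy's
experiment. -/
noncomputable def hardyVector (i : Fin S.N) (s : Fin (S.numMeas i)) : EuclideanSpace ℂ (Fin 2) :=
  if s = S.query i then diagonalQubit else EuclideanSpace.single 0 1

theorem norm_hardyVector (i : Fin S.N) (s : Fin (S.numMeas i)) : ‖hardyVector i s‖ = 1 := by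
  unfold hardyVector
  split_ifs
  · exact norm_diagonalQubit
  · simp

/-- Hardy's experiment for the parties `j` and `k`: the other parties always find `0`. -/
noncomputable def hardyProjection (j k i : Fin S.N) (s : Fin (S.numMeas i)) :
    EuclideanSpace ℂ (Fin 2) →L[ℂ] EuclideanSpace ℂ (Fin 2) :=
  if i = j ∨ i = k then InnerProductSpace.rankOne ℂ (hardyVector i s) (hardyVector i s) else 1

/-- There is a quantum behaviour with the possibilistic properties of Hardy's paradox. -/
theorem exists_mem_quantum_hardy {j k : Fin S.N} (hjk : j ≠ k) : ∃ p ∈ S.quantum,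
    (∀ x a, x j = S.query j → x k ≠ S.query k → p x a ≠ 0 → (a j : ℕ) = 0 → (a k : ℕ) = 0) ∧
    (∀ x a, x j ≠ S.query j → x k = S.query k → p x a ≠ 0 → (a k : ℕ) = 0 → (a j : ℕ) = 0) ∧
    (∀ x a, x j ≠ S.query j → x k ≠ S.query k → p x a ≠ 0 → (a j : ℕ) = 0 → (a k : ℕ) ≠ 0) ∧
    (∀ x a, x j = S.query j → x k = S.query k → (∀ i, (a i : ℕ) = 0) → p x a ≠ 0) := by
  let H : Fin S.N → Type := fun _ => EuclideanSpace ℂ (Fin 2)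
  let t := coordinateTensor (Fin S.N) (Fin 2)
  have ht : IsHilbertTensorProduct t := isHilbertTensorProduct_coordinateTensor _ _
  let E : (i : Fin S.N) → (s : Fin (S.numMeas i)) → Fin (S.numOut i s) →
      EuclideanSpace ℂ (Fin 2) →L[ℂ] EuclideanSpace ℂ (Fin 2) :=
    fun i s c => binaryEffect (hardyProjection j k i s) c
  have hE : ∀ i s c, (E i s c).IsPositive := fun i s c => by
    refine isPositive_binaryEffect ?_ c
    unfold hardyProjection
    split_ifs
    · exact InnerProductSpace.isStarProjection_rankOne_self (norm_hardyVector i s)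
    · exact .one _
  have hE1 : ∀ i s, ∑ c, E i s c = ContinuousLinearMap.id ℂ _ := fun i s =>
    sum_binaryEffect (S.two_le_numOut i s)
  let e : Fin 2 → EuclideanSpace ℂ (Fin 2) := fun r => EuclideanSpace.single r 1
  let W : (Fin S.N → EuclideanSpace ℂ (Fin 2)) → EuclideanSpace ℂ (Fin 2) →
      EuclideanSpace ℂ (Fin 2) → EuclideanSpace ℂ (Fin S.N → Fin 2) :=
    fun u α β => t (Function.update (Function.update u j α) k β)
  have hW0 : ∀ u α, W u α 0 = 0 := fun u α => t.map_coord_zero k (by simp)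
  have hW0' : ∀ u β, W u 0 β = 0 := fun u β => t.map_coord_zero j (by simp [hjk])
  let u₀ : Fin S.N → EuclideanSpace ℂ (Fin 2) := fun _ => e 0
  -- On the factors `j` and `k` this is e₀⊗e₁ + e₁⊗e₀ - e₁⊗e₁. It has no e₀⊗e₀ component, and its
  -- part with e₁ on one factor has e₀ - e₁ on the other, orthogonal to the diagonal vector. Its
  -- overlap with the product of two diagonal vectors is 1/2.
  let ψ := W u₀ (e 0) (e 1) + W u₀ (e 1) (e 0) - W u₀ (e 1) (e 1)
  have hT : ∀ (x : S.Inputs) (a : S.Outputs x),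
      tensorOperator ht (fun i => E i (x i) (a i)) ψ =
        W (fun i => E i (x i) (a i) (e 0)) (E j (x j) (a j) (e 0)) (E k (x k) (a k) (e 1)) +
        W (fun i => E i (x i) (a i) (e 0)) (E j (x j) (a j) (e 1)) (E k (x k) (a k) (e 0)) -
        W (fun i => E i (x i) (a i) (e 0)) (E j (x j) (a j) (e 1)) (E k (x k) (a k) (e 1)) := by
    intro x a
    have h : ∀ α β, tensorOperator ht (fun i => E i (x i) (a i)) (W u₀ α β) =
        W (fun i => E i (x i) (a i) (e 0)) (E j (x j) (a j) α) (E k (x k) (a k) β) := by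
      intro α β
      refine (tensorOperator_spec ht _ _).trans ?_
      refine congrArg t (funext fun i => ?_)
      by_cases hk : i = k
      · subst hk; simp
      · by_cases hj : i = j
        · subst hj; simp [hk]
        · simp [hk, hj, u₀]
    simp only [ψ, map_add, map_sub, h]
  have hd : ∀ r, ⟪diagonalQubit, e r⟫_ℂ = ((√2)⁻¹ : ℝ) := fun r => by
    fin_cases r <;> simp [e, diagonalQubit, EuclideanSpace.inner_single_right]
  have hdiag : ∀ i (s : Fin (S.numMeas i)) (c : Fin (S.numOut i s)), i = j ∨ i = k →
      s = S.query i → (c : ℕ) = 0 → ∀ r, E i s c (e r) = (((√2)⁻¹ : ℝ) : ℂ) • diagonalQubit := by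
    intro i s c hi hs hc r
    simp only [E, binaryEffect, hc, if_true, hardyProjection, hi, hardyVector, hs,
      InnerProductSpace.rankOne_apply, hd]
  have hcomp : ∀ i (s : Fin (S.numMeas i)), i = j ∨ i = k → s ≠ S.query i → ∀ r,
      hardyProjection j k i s (e r) = if r = 0 then e 0 else 0 := by
    intro i s hi hs r
    fin_cases r <;> simp [e, hardyProjection, hi, hardyVector, hs,
      EuclideanSpace.inner_single_right]
  have hne : ∀ (x : S.Inputs) (a : S.Outputs x), x j = S.query j → x k = S.query k →
      (∀ i, (a i : ℕ) = 0) → tensorOperator ht (fun i => E i (x i) (a i)) ψ ≠ 0 := by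
    intro x a hj hk ha
    have hdn : (((√2)⁻¹ : ℝ) : ℂ) • diagonalQubit ≠ 0 := by
      refine smul_ne_zero (by simp) fun h => ?_
      have := norm_diagonalQubit
      rw [h, norm_zero] at this
      exact zero_ne_one this
    -- The diagonal projection sends e₀ and e₁ to the same vector, so the three terms coincide and
    -- one of them survives: a product of nonzero vectors.
    rw [hT, hdiag j _ _ (.inl rfl) hj (ha j), hdiag j _ _ (.inl rfl) hj (ha j),
      hdiag k _ _ (.inr rfl) hk (ha k), hdiag k _ _ (.inr rfl) hk (ha k), add_sub_cancel_right]
    rw [← inner_self_ne_zero (𝕜 := ℂ)]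
    refine (ht.inner_tprod _ _).trans_ne ?_
    refine Finset.prod_ne_zero_iff.2 fun i _ => ?_
    rw [inner_self_ne_zero]
    by_cases hik : i = k
    · subst hik; simpa using hdn
    · by_cases hij : i = j
      · subst hij; simpa [hik] using hdn
      · simp [hik, hij, E, binaryEffect, ha i, hardyProjection, e]
  have hψ : ψ ≠ 0 := fun h => by
    refine hne S.query (fun i => ⟨0, lt_of_lt_of_le Nat.zero_lt_two (S.two_le_numOut _ _)⟩) rfl rfl
      (fun _ => rfl) ?_
    rw [h, map_zero]
  obtain ⟨p, hp, h⟩ := exists_mem_quantum_of_vector ht E hE hE1 hψ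
  refine ⟨p, hp, ?_, ?_, ?_, ?_⟩
  · intro x a hj hk hpa haj
    by_contra hak
    refine hpa ((h x a).2 ?_)
    have h1 : E k (x k) (a k) (e 0) = 0 :=
      binaryEffect_apply_of_ne_zero (by simp [hcomp k _ (.inr rfl) hk]) hak
    rw [hT, h1, hW0, hdiag j _ _ (.inl rfl) hj haj, hdiag j _ _ (.inl rfl) hj haj, add_zero,
      sub_self]
  · intro x a hj hk hpa hak
    by_contra haj
    refine hpa ((h x a).2 ?_)
    have h1 : E j (x j) (a j) (e 0) = 0 :=
      binaryEffect_apply_of_ne_zero (by simp [hcomp j _ (.inl rfl) hj]) haj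
    rw [hT, h1, hW0', hdiag k _ _ (.inr rfl) hk hak, hdiag k _ _ (.inr rfl) hk hak, zero_add,
      sub_self]
  · intro x a hj hk hpa haj hak
    refine hpa ((h x a).2 ?_)
    have h1 : E j (x j) (a j) (e 1) = 0 := by
      simp [E, binaryEffect, haj, hcomp j _ (.inl rfl) hj]
    have h2 : E k (x k) (a k) (e 1) = 0 := by
      simp [E, binaryEffect, hak, hcomp k _ (.inr rfl) hk]
    rw [hT, h1, h2, hW0, hW0', hW0, add_zero, sub_self]
  · intro x a hj hk ha hpa
    exact hne x a hj hk ha ((h x a).1 hpa)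

/-- Hardy's paradox cannot occur in Local Friendliness models when one of the measurements that
lead to the paradoxical event is the query of a friend. -/
theorem notMem_localFriendliness_of_hardy {p : S.Table} {j k : Fin S.N} (hj : j ∈ S.friends)
    {x₀₀ x₀₁ x₁₀ x₁₁ : S.Inputs} (h00 : x₀₀ j = S.query j) (h01 : x₀₁ j = S.query j)
    (h1 : x₁₀ j = x₁₁ j) (hk0 : x₀₀ k = x₁₀ k) (hk1 : x₁₁ k = x₀₁ k)
    (hp01 : ∀ a, p x₀₁ a ≠ 0 → (a j : ℕ) = 0 → (a k : ℕ) = 0)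
    (hp10 : ∀ a, p x₁₀ a ≠ 0 → (a k : ℕ) = 0 → (a j : ℕ) = 0)
    (hp11 : ∀ a, p x₁₁ a ≠ 0 → (a j : ℕ) = 0 → (a k : ℕ) ≠ 0)
    {a : S.Outputs x₀₀} (ha : p x₀₀ a ≠ 0) (haj : (a j : ℕ) = 0) (hak : (a k : ℕ) = 0) :
    p ∉ S.localFriendliness := by
  intro hp
  obtain ⟨-, w, Q, hw, -, hQ, hL, hd, rfl⟩ := mem_localFriendliness_iff.1 hp
  -- Fix a `c` that admits the paradoxical event; it fixes the query outcome of `j` to `0`. Within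
  -- this component, supports are followed around the four contexts: outcome `0` of `k` passes to
  -- `x₁₀` and forces `0` for `j`, which passes to `x₁₁` and forces a nonzero value of `k`, which
  -- passes to `x₀₁`, where `j` reports `0` and forces `0` for `k`.
  obtain ⟨c, -, hc⟩ := Finset.exists_ne_zero_of_sum_ne_zero ha
  have hsupp : ∀ x (b : S.Outputs x), Q c x b ≠ 0 → ∑ c, Q c x b * w c ≠ 0 := by
    intro x b hb h0
    have h := (Finset.sum_eq_zero_iff_of_nonneg fun c _ => mul_nonneg ((hQ c).1 x b) (hw c)).1 h0 c
      (Finset.mem_univ c)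
    exact mul_ne_zero hb (right_ne_zero_of_mul hc) h
  have hc0 := left_ne_zero_of_mul hc
  have hcj : (c ⟨j, hj⟩ : ℕ) = 0 := by rw [← hd c x₀₀ a hc0 ⟨j, hj⟩ h00, haj]
  obtain ⟨b, hb, hbk⟩ := (hL c).exists_support (hQ c) hk0 hc0
  have hbj := hp10 b (hsupp _ b hb) (hbk.trans hak)
  obtain ⟨d, hdQ, hdj⟩ := (hL c).exists_support (hQ c) h1 hb
  have hdk := hp11 d (hsupp _ d hdQ) (hdj.trans hbj)
  obtain ⟨f, hf, hfk⟩ := (hL c).exists_support (hQ c) hk1 hdQ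
  refine hdk (hfk.symm.trans (hp01 f (hsupp _ f hf) ?_))
  rw [hd c x₀₁ f hf ⟨j, hj⟩ h01, hcj]

theorem not_quantum_subset_localFriendliness (h : S.friends.Nonempty) :
    ¬ S.quantum ⊆ S.localFriendliness := by
  intro hsub
  obtain ⟨j, hj⟩ := h
  have : Nontrivial (Fin S.N) := Fin.nontrivial_iff_two_le.2 S.two_le_N
  obtain ⟨k, hkj⟩ := exists_ne j
  have hm : ∀ i, ∃ s, s ≠ S.query i := fun i => by
    have : Nontrivial (Fin (S.numMeas i)) := Fin.nontrivial_iff_two_le.2 (S.two_le_numMeas i)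
    exact exists_ne _
  choose s hs using hm
  obtain ⟨p, hp, h01, h10, h11, h00⟩ := exists_mem_quantum_hardy hkj.symm
  let z : S.Outputs S.query := fun i => ⟨0, lt_of_lt_of_le Nat.zero_lt_two (S.two_le_numOut _ _)⟩
  -- Only the settings of `j` and `k` enter the Hardy conditions, so the other parties may also
  -- switch in the fourth context `s`.
  refine notMem_localFriendliness_of_hardy (p := p) (j := j) (k := k) hj (x₀₀ := S.query)
    (x₀₁ := Function.update S.query k (s k)) (x₁₀ := Function.update S.query j (s j)) (x₁₁ := s)
    rfl (by simp [hkj.symm]) (by simp) (by simp [hkj]) (by simp) (fun a => h01 _ a ?_ ?_)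
    (fun a => h10 _ a ?_ ?_) (fun a => h11 _ a (hs j) (hs k)) (a := z)
    (h00 S.query z rfl rfl fun _ => rfl) rfl rfl (hsub hp)
  all_goals simp [hkj, hkj.symm, hs]

end LFScenario

namespace LFScenario

variable {S : LFScenario}

/-! ## Bell-local behaviours are Local Friendliness behaviours -/

open MeasureTheory

section LocalResponses

variable {L : Type}
  {R : (i : Fin S.N) → (s : Fin (S.numMeas i)) → Fin (S.numOut i s) → L → ℝ}

theorem response_le_one (h0 : ∀ i s c l, 0 ≤ R i s c l) (h1 : ∀ i s l, ∑ c, R i s c l = 1)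
    (i : Fin S.N) (s : Fin (S.numMeas i)) (c : Fin (S.numOut i s)) (l : L) : R i s c l ≤ 1 := by
  rw [← h1 i s l]
  exact Finset.single_le_sum (f := fun c => R i s c l) (fun c _ => h0 i s c l) (Finset.mem_univ c)

variable [MeasurableSpace L]

theorem integrable_prod_response (μ : Measure L) [IsFiniteMeasure μ]
    (hm : ∀ i s c, Measurable (R i s c)) (h0 : ∀ i s c l, 0 ≤ R i s c l)
    (h1 : ∀ i s l, ∑ c, R i s c l = 1) (x : S.Inputs) (a : S.Outputs x) :
    Integrable (fun l => ∏ i, R i (x i) (a i) l) μ := by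
  refine Integrable.of_bound (C := 1)
    (Finset.measurable_fun_prod _ fun i _ => hm i _ _).aestronglyMeasurable
    (Filter.Eventually.of_forall fun l => ?_)
  rw [Real.norm_of_nonneg (Finset.prod_nonneg fun i _ => h0 i _ _ l)]
  exact Finset.prod_le_one (fun i _ => h0 i _ _ l) fun i _ => response_le_one h0 h1 i _ _ l

variable {μ : Measure L} [IsProbabilityMeasure μ]

/-- The responses of the parties outside `V` sum to one under the integral; Local Agency is visible
from the result. -/
theorem marginal_integral (hm : ∀ i s c, Measurable (R i s c)) (h0 : ∀ i s c l, 0 ≤ R i s c l)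
    (h1 : ∀ i s l, ∑ c, R i s c l = 1) (V : Finset (Fin S.N)) (x : S.Inputs) (a : S.Outputs x) :
    S.marginal (fun x a => ∫ l, ∏ i, R i (x i) (a i) l ∂μ) V x a =
      ∫ l, ∏ i ∈ V, R i (x i) (a i) l ∂μ := by
  rw [marginal, ← Finset.sum_filter, ← integral_finsetSum _ fun b _ =>
    integrable_prod_response μ hm h0 h1 x b]
  congr 1
  funext l
  let C : (i : Fin S.N) → Finset (Fin (S.numOut i (x i))) := fun i =>
    if i ∈ V then {a i} else Finset.univ
  have hC : Finset.univ.filter (fun b : S.Outputs x => ∀ i ∈ V, b i = a i) =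
      Fintype.piFinset C := by
    ext b
    simp only [Finset.mem_filter, Finset.mem_univ, true_and, Fintype.mem_piFinset, C]
    refine forall_congr' fun i => ?_
    by_cases hi : i ∈ V <;> simp [hi]
  rw [hC, ← Finset.prod_univ_sum C fun i c => R i (x i) c l, ← Finset.prod_subset (Finset.subset_univ V)]
  · refine Finset.prod_congr rfl fun i hi => ?_
    simp [C, hi]
  · intro i _ hi
    simp [C, hi, h1]

theorem isBehaviour_integral (hm : ∀ i s c, Measurable (R i s c)) (h0 : ∀ i s c l, 0 ≤ R i s c l)
    (h1 : ∀ i s l, ∑ c, R i s c l = 1) :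
    S.IsBehaviour fun x a => ∫ l, ∏ i, R i (x i) (a i) l ∂μ := by
  refine ⟨fun x a => integral_nonneg fun l => Finset.prod_nonneg fun i _ => h0 i _ _ l,
    fun x => ?_⟩
  have h := marginal_integral (μ := μ) hm h0 h1 ∅ x
    fun i => ⟨0, lt_of_lt_of_le Nat.zero_lt_two (S.two_le_numOut i (x i))⟩
  simpa [marginal] using h

theorem localAgency_integral (hm : ∀ i s c, Measurable (R i s c)) (h0 : ∀ i s c l, 0 ≤ R i s c l)
    (h1 : ∀ i s l, ∑ c, R i s c l = 1) :
    S.LocalAgency fun x a => ∫ l, ∏ i, R i (x i) (a i) l ∂μ := by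
  intro V x x' a a' hx ha
  rw [marginal_integral hm h0 h1, marginal_integral hm h0 h1]
  have key : ∀ (i : Fin S.N) (s s' : Fin (S.numMeas i)) (c : Fin (S.numOut i s))
      (c' : Fin (S.numOut i s')), s = s' → (c : ℕ) = c' → R i s c = R i s' c' := by
    rintro i s _ c c' rfl hc
    rw [Fin.ext hc]
  congr 1
  funext l
  exact Finset.prod_congr rfl fun i hi => by rw [key i _ _ _ _ (hx i hi) (ha i hi)]

end LocalResponses

/-- Conditioning a probability measure on a bounded nonnegative weight. -/
theorem exists_conditional_measure {L : Type} [MeasurableSpace L] (μ : Measure L)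
    [IsProbabilityMeasure μ] {g : L → ℝ} (hg : Measurable g) (h0 : ∀ l, 0 ≤ g l)
    (h1 : ∀ l, g l ≤ 1) : ∃ ν : Measure L, IsProbabilityMeasure ν ∧
      ∀ f : L → ℝ, (∫ l, f l ∂ν) * ∫ l, g l ∂μ = ∫ l, g l * f l ∂μ := by
  have hgi : Integrable g μ := Integrable.of_bound (C := 1) hg.aestronglyMeasurable
    (Filter.Eventually.of_forall fun l => by rw [Real.norm_of_nonneg (h0 l)]; exact h1 l)
  by_cases hw : ∫ l, g l ∂μ = 0
  -- For total weight zero both sides vanish, and any probability measure will do.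
  · refine ⟨μ, inferInstance, fun f => ?_⟩
    have hae := (integral_eq_zero_iff_of_nonneg h0 hgi).1 hw
    rw [hw, mul_zero, integral_eq_zero_of_ae]
    filter_upwards [hae] with l hl
    simp [hl]
  · have hpos : 0 < ∫ l, g l ∂μ := lt_of_le_of_ne (integral_nonneg h0) (Ne.symm hw)
    refine ⟨(ENNReal.ofReal (∫ l, g l ∂μ))⁻¹ • μ.withDensity fun l => ENNReal.ofReal (g l),
      ⟨?_⟩, fun f => ?_⟩
    · rw [Measure.smul_apply, withDensity_apply _ MeasurableSet.univ, Measure.restrict_univ,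
        ← ofReal_integral_eq_lintegral_ofReal hgi (Filter.Eventually.of_forall h0), smul_eq_mul]
      exact ENNReal.inv_mul_cancel (by simpa using hpos) ENNReal.ofReal_ne_top
    · rw [integral_smul_measure, integral_withDensity_eq_integral_toReal_smul
        hg.ennreal_ofReal (Filter.Eventually.of_forall fun _ => ENNReal.ofReal_lt_top),
        ENNReal.toReal_inv, ENNReal.toReal_ofReal hpos.le, smul_eq_mul, mul_comm,
        mul_inv_cancel_left₀ hw]
      simp [ENNReal.toReal_ofReal (h0 _)]

theorem sum_ite_val_eq {n v : ℕ} (hv : v < n) :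
    ∑ o : Fin n, (if (o : ℕ) = v then (1 : ℝ) else 0) = 1 := by
  rw [Finset.sum_eq_single ⟨v, hv⟩ (fun o _ ho => if_neg fun h => ho (Fin.ext h)) (by simp)]
  simp

/-- Let `g c l` be the probability that all friends would record `c` at hidden value `l`. The weight
of `c` is the integral of `g c`, the hidden variable is conditioned on `c`, and queries of friends
are answered by `c`. Summing over `c` restores the original product pointwise in `l`. -/
theorem bellLocal_subset_localFriendliness : S.bellLocal ⊆ S.localFriendliness := by
  rintro p ⟨hp, L, _, μ, P, _, hm, h0, h1, h⟩
  let g : S.FriendOutcomes → L → ℝ := fun c l => ∏ i : S.friends, P i.1 (S.query i.1) (c i) l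
  have hg : ∀ c, Measurable (g c) := fun c => Finset.measurable_fun_prod _ fun i _ => hm _ _ _
  have hg0 : ∀ c l, 0 ≤ g c l := fun c l => Finset.prod_nonneg fun i _ => h0 _ _ _ l
  have hg1 : ∀ c l, g c l ≤ 1 := fun c l =>
    Finset.prod_le_one (fun i _ => h0 _ _ _ l) fun i _ => response_le_one h0 h1 _ _ _ l
  have hgs : ∀ l, ∑ c, g c l = 1 := fun l => by
    simp only [g]
    have hf := Finset.prod_univ_sum (fun i : S.friends => Finset.univ)
      fun i d => P i.1 (S.query i.1) d l
    rw [Fintype.piFinset_univ] at hf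
    rw [← hf]
    simp [h1]
  have hgi : ∀ c, Integrable (g c) μ := fun c => Integrable.of_bound (C := 1)
    (hg c).aestronglyMeasurable
    (Filter.Eventually.of_forall fun l => by rw [Real.norm_of_nonneg (hg0 c l)]; exact hg1 c l)
  choose ν hν hνg using fun c => exists_conditional_measure μ (hg c) (hg0 c) (hg1 c)
  let R : S.FriendOutcomes → (i : Fin S.N) → (s : Fin (S.numMeas i)) →
      Fin (S.numOut i s) → L → ℝ := fun c i s o l =>
    if hi : i ∈ S.friends ∧ s = S.query i then
      if (o : ℕ) = c ⟨i, hi.1⟩ then 1 else 0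
    else P i s o l
  have hRm : ∀ c i s o, Measurable (R c i s o) := fun c i s o => by
    by_cases hi : i ∈ S.friends ∧ s = S.query i
    · simp only [R, hi, and_self, dif_pos]
      exact measurable_const
    · simp only [R, hi, dif_neg, not_false_eq_true]
      exact hm i s o
  have hR0 : ∀ c i s o l, 0 ≤ R c i s o l := fun c i s o l => by
    simp only [R]
    split_ifs
    exacts [zero_le_one, le_rfl, h0 i s o l]
  have hR1 : ∀ c i s l, ∑ o, R c i s o l = 1 := fun c i s l => by
    by_cases hi : i ∈ S.friends ∧ s = S.query i
    · obtain ⟨hi, rfl⟩ := hi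
      simp only [R, hi, and_self, dif_pos]
      exact sum_ite_val_eq (c ⟨i, hi⟩).2
    · simp only [R, hi, dif_neg, not_false_eq_true]
      exact h1 i s l
  have hprod : ∀ x (a : S.Outputs x) l,
      ∑ c, g c l * ∏ i, R c i (x i) (a i) l = ∏ i, P i (x i) (a i) l := by
    intro x a l
    -- The factor of friend `i` together with its share of `g c`. Summed over the recorded value `d`
    -- it gives back the original response: the delta selects it if `i` is queried, otherwise the
    -- share sums to one.
    let r : (i : S.friends) → Fin (S.numOut i.1 (S.query i.1)) → ℝ := fun i d =>
      P i.1 (S.query i.1) d l *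
        if x i.1 = S.query i.1 then if (a i.1 : ℕ) = d then 1 else 0 else P i.1 (x i.1) (a i.1) l
    have hsplit : ∀ c, g c l * ∏ i, R c i (x i) (a i) l =
        (∏ i : S.friends, r i (c i)) *
          ∏ i ∈ S.friendsᶜ, P i (x i) (a i) l := by
      intro c
      rw [← Finset.prod_mul_prod_compl S.friends, ← mul_assoc, ← Finset.prod_coe_sort S.friends,
        show g c l = ∏ i : S.friends, P i.1 (S.query i.1) (c i) l from rfl,
        ← Finset.prod_mul_distrib]
      congr 1
      · refine Finset.prod_congr rfl fun i _ => ?_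
        simp [R, r]
      · refine Finset.prod_congr rfl fun i hi => ?_
        simp [R, Finset.mem_compl.1 hi]
    have hr : ∀ i : S.friends, ∑ d, r i d = P i.1 (x i.1) (a i.1) l := by
      intro i
      by_cases hi : x i.1 = S.query i.1
      · simp only [r, if_pos hi]
        have hlt : (a i.1 : ℕ) < S.numOut i.1 (S.query i.1) :=
          (a i.1).2.trans_eq (congrArg _ hi)
        rw [Finset.sum_eq_single ⟨a i.1, hlt⟩]
        · have key : ∀ (i : Fin S.N) (s s' : Fin (S.numMeas i)) (c : Fin (S.numOut i s))
              (c' : Fin (S.numOut i s')), s = s' → (c : ℕ) = c' → P i s c l = P i s' c' l := by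
            rintro i s _ c c' rfl hc
            rw [Fin.ext hc]
          simpa using key i.1 _ _ _ _ hi.symm rfl
        · intro d _ hd
          rw [if_neg fun h => hd (Fin.ext h.symm), mul_zero]
        · simp
      · simp only [r, if_neg hi]
        rw [← Finset.sum_mul, h1, one_mul]
    simp only [hsplit]
    have hf := Finset.prod_univ_sum (fun i : S.friends => Finset.univ) r
    rw [Fintype.piFinset_univ] at hf
    rw [← Finset.sum_mul, ← hf]
    simp only [hr]
    rw [Finset.prod_coe_sort S.friends fun i => P i (x i) (a i) l]
    exact Finset.prod_mul_prod_compl S.friends _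
  refine mem_localFriendliness_iff.2 ⟨hp, fun c => ∫ l, g c l ∂μ,
    fun c x a => ∫ l, ∏ i, R c i (x i) (a i) l ∂(ν c), fun c => integral_nonneg (hg0 c), ?_,
    fun c => isBehaviour_integral (hRm c) (hR0 c) (hR1 c),
    fun c => localAgency_integral (hRm c) (hR0 c) (hR1 c), ?_, ?_⟩
  · rw [← integral_finsetSum _ fun c _ => hgi c]
    simp [hgs]
  · intro c x a hne i hi
    by_contra hai
    refine hne ?_
    have : ∀ l, ∏ i, R c i (x i) (a i) l = 0 := fun l =>
      Finset.prod_eq_zero (Finset.mem_univ i.1) (by simp [R, hi, hai])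
    simp [this]
  · funext x a
    simp only [hνg]
    rw [h x a, ← integral_finsetSum]
    · simp only [hprod]
    · intro c _
      refine Integrable.of_bound (C := 1) ((hg c).mul
        (Finset.measurable_fun_prod _ fun i _ => hRm c i _ _)).aestronglyMeasurable
        (Filter.Eventually.of_forall fun l => ?_)
      have hR : 0 ≤ ∏ i, R c i (x i) (a i) l := Finset.prod_nonneg fun i _ => hR0 c i _ _ l
      rw [Real.norm_of_nonneg (mul_nonneg (hg0 c l) hR)]
      exact mul_le_one₀ (hg1 c l) hR
        (Finset.prod_le_one (fun i _ => hR0 c i _ _ l) fun i _ =>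
          response_le_one (hR0 c) (hR1 c) i _ _ l)

/-! ## Local Friendliness with a single free party is Bell-local -/

theorem mem_bellLocal_of_sum {p : S.Table} (hp : S.IsBehaviour p) {L : Type} [Fintype L]
    {w : L → ℝ} (hw : ∀ l, 0 ≤ w l) (hw1 : ∑ l, w l = 1)
    {R : (i : Fin S.N) → (s : Fin (S.numMeas i)) → Fin (S.numOut i s) → L → ℝ}
    (h0 : ∀ i s c l, 0 ≤ R i s c l) (h1 : ∀ i s l, ∑ c, R i s c l = 1)
    (h : ∀ x a, p x a = ∑ l, w l * ∏ i, R i (x i) (a i) l) : p ∈ S.bellLocal := by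
  let _ : MeasurableSpace L := ⊤
  have hint : ∀ f : L → ℝ,
      ∫ l, f l ∂(∑ l, ENNReal.ofReal (w l) • Measure.dirac l) = ∑ l, w l * f l := by
    intro f
    rw [integral_finsetSum_measure]
    · simp [integral_smul_measure, ENNReal.toReal_ofReal (hw _)]
    · exact fun l _ => (integrable_dirac (by simp)).smul_measure ENNReal.ofReal_ne_top
  refine ⟨hp, L, ⊤, ∑ l, ENNReal.ofReal (w l) • Measure.dirac l, R, ⟨?_⟩,
    fun i s c => measurable_from_top, h0, h1, fun x a => by rw [hint, h]⟩
  simp only [Measure.coe_finsetSum, Finset.sum_apply, Measure.smul_apply, measure_univ,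
    smul_eq_mul, mul_one]
  rw [← ENNReal.ofReal_sum_of_nonneg fun l _ => hw l, hw1, ENNReal.ofReal_one]

/-- If every party but `k` has only one measurement whose outcome is not fixed, a behaviour
that satisfies Local Agency has a local hidden variable model. -/
theorem LocalAgency.exists_local_model {Q : S.Table} (hQ : S.IsBehaviour Q)
    (hL : S.LocalAgency Q) {k : Fin S.N} {c : Fin S.N → ℕ}
    (hc : ∀ i, i ≠ k → c i < S.numOut i (S.query i))
    (hd : ∀ x a, Q x a ≠ 0 → ∀ i, i ≠ k → x i = S.query i → (a i : ℕ) = c i)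
    {y : S.Inputs} (hy : ∀ i, i ≠ k → ∀ s, s ≠ S.query i → s = y i) :
    ∃ R : (i : Fin S.N) → (s : Fin (S.numMeas i)) → Fin (S.numOut i s) → S.Outputs y → ℝ,
      (∀ i s o d, 0 ≤ R i s o d) ∧ (∀ i s d, ∑ o, R i s o d = 1) ∧
      ∀ x a, Q x a = ∑ d, Q y d * ∏ i, R i (x i) (a i) d := by
  -- The contexts in which `k` is free to choose and all others choose the measurement given by `y`.
  let z : Fin (S.numMeas k) → S.Inputs := fun s => Function.update y k s
  have hzk : ∀ s, z s k = s := fun s => by simp [z]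
  have hz : ∀ s i, i ≠ k → z s i = y i := fun s i hi => by simp [z, hi]
  let agree : ∀ {s}, S.Outputs (z s) → S.Outputs y → Prop := fun b d =>
    ∀ i, i ≠ k → (b i : ℕ) = d i
  let m : S.Outputs y → ℝ := S.marginal Q (Finset.univ.erase k) y
  have hm0 : ∀ d, 0 ≤ m d := marginal_nonneg hQ _ y
  have hmz : ∀ s (b : S.Outputs (z s)) d, agree b d →
      S.marginal Q (Finset.univ.erase k) (z s) b = m d := fun s b d h =>
    hL _ _ _ _ _ (fun i hi => hz s i (Finset.ne_of_mem_erase hi))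
      fun i hi => h i (Finset.ne_of_mem_erase hi)
  classical
  have hsum : ∀ s d, ∑ b : S.Outputs (z s), (if agree b d then Q (z s) b else 0) = m d := by
    intro s d
    have ht : agree (transport (z s) d) d := fun i hi => transport_val d (hz s i hi).symm
    rw [← hmz s _ d ht, marginal]
    refine Finset.sum_congr rfl fun b _ => ?_
    refine if_congr ?_ rfl rfl
    simp only [agree, Finset.mem_erase, Finset.mem_univ, and_true]
    refine forall₂_congr fun i hi => ?_
    rw [Fin.ext_iff, ht i hi]
  have hsum' : ∀ s (b : S.Outputs (z s)), ∑ d, (if agree b d then Q y d else 0) =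
      S.marginal Q (Finset.univ.erase k) (z s) b := by
    intro s b
    have ht : agree b (transport y b) := fun i hi => (transport_val b (hz s i hi)).symm
    rw [hmz s b _ ht]
    refine Finset.sum_congr rfl fun d _ => ?_
    refine if_congr ?_ rfl rfl
    simp only [agree, Finset.mem_erase, Finset.mem_univ, and_true]
    refine forall₂_congr fun i hi => ?_
    rw [Fin.ext_iff, ht i hi, eq_comm]
  let num : (s : Fin (S.numMeas k)) → ℕ → S.Outputs y → ℝ := fun s o d =>
    ∑ b : S.Outputs (z s), if agree b d ∧ o = b k then Q (z s) b else 0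
  let R : (i : Fin S.N) → (s : Fin (S.numMeas i)) → Fin (S.numOut i s) → S.Outputs y → ℝ :=
    fun i s o d =>
      if h : i = k then
        if m d = 0 then if (o : ℕ) = 0 then 1 else 0 else num (h ▸ s) o d / m d
      else if (o : ℕ) = if s = S.query i then c i else d i then 1 else 0
  have hRk : ∀ s (o : Fin (S.numOut k s)) d,
      R k s o d = if m d = 0 then if (o : ℕ) = 0 then 1 else 0 else num s o d / m d :=
    fun s o d => by simp [R]
  have hRi : ∀ i, i ≠ k → ∀ s (o : Fin (S.numOut i s)) d, R i s o d =
      if (o : ℕ) = if s = S.query i then c i else d i then 1 else 0 :=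
    fun i hi s o d => by simp [R, hi]
  have hnum0 : ∀ s o d, 0 ≤ num s o d := fun s o d =>
    Finset.sum_nonneg fun b _ => by split_ifs; exacts [hQ.1 _ b, le_rfl]
  refine ⟨R, fun i s o d => ?_, fun i s d => ?_, fun x a => ?_⟩
  · by_cases hi : i = k
    · subst hi
      rw [hRk]
      split_ifs
      exacts [zero_le_one, le_rfl, div_nonneg (hnum0 _ _ _) (hm0 d)]
    · rw [hRi i hi]
      split_ifs <;> norm_num
  · by_cases hi : i = k
    · subst hi
      simp only [hRk]
      by_cases hmd : m d = 0
      · simp only [hmd, if_true]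
        exact sum_ite_val_eq (lt_of_lt_of_le Nat.zero_lt_two (S.two_le_numOut _ _))
      · simp only [hmd, if_false]
        rw [← Finset.sum_div, div_eq_one_iff_eq hmd, ← hsum s d, Finset.sum_comm]
        refine Finset.sum_congr rfl fun b _ => ?_
        have hlt : (b i : ℕ) < S.numOut i s := (b i).2.trans_eq (by rw [hzk])
        rw [Finset.sum_eq_single ⟨b i, hlt⟩
          (fun o _ ho => if_neg fun h => ho (Fin.ext h.2)) (by simp)]
        simp
    · simp only [hRi i hi]
      refine sum_ite_val_eq ?_
      split_ifs with hs
      · subst hs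
        exact hc i hi
      · rw [hy i hi s hs]
        exact (d i).2
  · let E : (Fin S.N → ℕ) → Prop := fun v =>
      ∀ i, i ≠ k → (a i : ℕ) = if x i = S.query i then c i else v i
    have hE : ∀ (b : S.Outputs (z (x k))) (d : S.Outputs y), agree b d →
        (E (fun i => d i) ↔ E (fun i => b i)) := fun b d h =>
      forall₂_congr fun i hi => by simp only [h i hi]
    have hprod : ∀ d, ∏ i, R i (x i) (a i) d =
        R k (x k) (a k) d * if E (fun i => d i) then 1 else 0 := by
      intro d
      rw [← Finset.mul_prod_erase _ _ (Finset.mem_univ k)]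
      congr 1
      rw [Finset.prod_congr rfl fun i hi => hRi i (Finset.ne_of_mem_erase hi) (x i) (a i) d,
        Finset.prod_ite_zero]
      simp [E]
    -- Written as a sum over strings `b` of context `z (x k)`, so that after exchanging the sums the
    -- sum over `d` cancels the denominator of the conditional probability.
    have hterm : ∀ d, Q y d * ∏ i, R i (x i) (a i) d = ∑ b : S.Outputs (z (x k)),
        if E (fun i => b i) ∧ (a k : ℕ) = b k then
          Q (z (x k)) b / S.marginal Q (Finset.univ.erase k) (z (x k)) b *
            (if agree b d then Q y d else 0) else 0 := by
      intro d
      rw [hprod, hRk]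
      by_cases hmd : m d = 0
      · have hq : Q y d = 0 := le_antisymm ((le_marginal hQ _ y d).trans_eq hmd) (hQ.1 y d)
        simp [hq]
      · rw [if_neg hmd, Finset.sum_div, Finset.sum_mul, Finset.mul_sum]
        refine Finset.sum_congr rfl fun b _ => ?_
        by_cases hbd : agree b d
        · simp only [hE b d hbd, hmz _ b d hbd, hbd, true_and, if_true]
          by_cases h1 : E (fun i => b i) <;> by_cases h2 : (a k : ℕ) = b k <;> simp [h1, h2]
          ring
        · simp [hbd]
    simp only [hterm]
    rw [Finset.sum_comm]
    have hb : ∀ b : S.Outputs (z (x k)), (∑ d, if E (fun i => b i) ∧ (a k : ℕ) = b k then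
        Q (z (x k)) b / S.marginal Q (Finset.univ.erase k) (z (x k)) b *
          (if agree b d then Q y d else 0) else 0) =
        if E (fun i => b i) ∧ (a k : ℕ) = b k then Q (z (x k)) b else 0 := by
      intro b
      by_cases h : E (fun i => b i) ∧ (a k : ℕ) = b k
      · simp only [if_pos h]
        rw [← Finset.mul_sum, hsum']
        refine div_mul_cancel_of_imp fun h0 => ?_
        exact le_antisymm ((le_marginal hQ _ _ b).trans_eq h0) (hQ.1 _ b)
      · simp only [if_neg h, Finset.sum_const_zero]
    simp only [hb]
    by_cases hq : ∀ i, i ≠ k → x i = S.query i → (a i : ℕ) = c i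
    -- Outside `W` the outcomes are fixed by `c`, so `Q x a` is already a marginal on `W`. There `x`
    -- agrees with `z (x k)`, and Local Agency moves the marginal to that context.
    · let W : Finset (Fin S.N) := {i | i = k ∨ x i ≠ S.query i}
      have hxz : ∀ i ∈ W, x i = z (x k) i := by
        intro i hi
        by_cases hik : i = k
        · subst hik; rw [hzk]
        · rw [hz _ i hik]
          refine hy i hik _ ?_
          simpa [W, hik] using hi
      have h1 : Q x a = S.marginal Q W x a := by
        rw [marginal, Finset.sum_eq_single a]
        · simp
        · intro b _ hba
          by_contra hne
          have hW : ∀ i ∈ W, b i = a i := by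
            by_contra h
            exact hne (if_neg h)
          rw [if_pos hW] at hne
          refine hba (funext fun i => ?_)
          by_cases hi : i ∈ W
          · exact hW i hi
          · have hi' : i ≠ k ∧ x i = S.query i := by simpa [W] using hi
            exact Fin.ext ((hd x b hne i hi'.1 hi'.2).trans (hq i hi'.1 hi'.2).symm)
        · simp
      rw [h1, hL W x (z (x k)) a (transport _ a) hxz fun i hi => (transport_val a (hxz i hi)).symm]
      refine Finset.sum_congr rfl fun b _ => if_congr ?_ rfl rfl
      constructor
      · intro h
        refine ⟨fun i hi => ?_, ?_⟩
        · split_ifs with hxi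
          · exact hq i hi hxi
          · have hiW : i ∈ W := by simp [W, hxi]
            simp only [h i hiW, transport_val a (hxz i hiW)]
        · have hkW : k ∈ W := by simp [W]
          rw [h k hkW, transport_val a (hxz k hkW)]
      · rintro ⟨h, hk⟩ i hi
        refine Fin.ext ?_
        rw [transport_val a (hxz i hi)]
        by_cases hik : i = k
        · subst hik; exact hk.symm
        · have hxi : x i ≠ S.query i := by simpa [W, hik] using hi
          rw [h i hik, if_neg hxi]
    · have hQ0 : Q x a = 0 := by
        by_contra hne
        exact hq (hd x a hne)
      rw [hQ0, Finset.sum_eq_zero]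
      intro b _
      refine if_neg fun h => hq fun i hi hxi => ?_
      rw [h.1 i hi, if_pos hxi]

theorem localFriendliness_subset_bellLocal {k : Fin S.N} (hk : ∀ i, i ≠ k → i ∈ S.friends)
    {y : S.Inputs} (hy : ∀ i, i ≠ k → ∀ s, s ≠ S.query i → s = y i) :
    S.localFriendliness ⊆ S.bellLocal := by
  intro p hp
  obtain ⟨hb, w, Q, hw, hw1, hQ, hL, hd, rfl⟩ := mem_localFriendliness_iff.1 hp
  have hR : ∀ c, ∃ R : (i : Fin S.N) → (s : Fin (S.numMeas i)) → Fin (S.numOut i s) →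
      S.Outputs y → ℝ, (∀ i s o d, 0 ≤ R i s o d) ∧ (∀ i s d, ∑ o, R i s o d = 1) ∧
      ∀ x a, Q c x a = ∑ d, Q c y d * ∏ i, R i (x i) (a i) d := fun c =>
    LocalAgency.exists_local_model (hQ c) (hL c) (k := k)
      -- Only `k` can lack a friend, and the value at `k` is never used, so the default `0` is
      -- harmless.
      (c := fun i => if h : i ∈ S.friends then c ⟨i, h⟩ else 0)
      (fun i hi => by simp [hk i hi])
      (fun x a hne i hi hx => by rw [dif_pos (hk i hi)]; exact hd c x a hne ⟨i, hk i hi⟩ hx) hy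
  choose R hR0 hR1 hRQ using hR
  -- The full hidden variable is the pair of the friends' string and the outcome string in context
  -- `y`.
  refine mem_bellLocal_of_sum hb (L := S.FriendOutcomes × S.Outputs y)
    (w := fun l => w l.1 * Q l.1 y l.2) (R := fun i s o l => R l.1 i s o l.2)
    (fun l => mul_nonneg (hw _) ((hQ _).1 _ _)) ?_ (fun i s o l => hR0 _ _ _ _ _)
    (fun i s l => hR1 _ _ _ _) fun x a => ?_
  · rw [Fintype.sum_prod_type]
    simp only [← Finset.mul_sum, (hQ _).2, mul_one, hw1]
  · rw [Fintype.sum_prod_type]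
    refine Finset.sum_congr rfl fun c _ => ?_
    simp only [mul_assoc]
    rw [← Finset.mul_sum, ← hRQ, mul_comm]

/-! ## The three cases -/

theorem quantumInsideLF_of_friends_eq_empty (h : S.friends = ∅) : S.QuantumInsideLF := by
  have heq : S.localFriendliness = S.noSignalling :=
    localFriendliness_subset_noSignalling.antisymm (noSignalling_subset_localFriendliness h)
  refine ⟨⟨heq ▸ quantum_subset_noSignalling, fun hsub => ?_⟩, heq⟩
  let j : Fin S.N := ⟨0, lt_of_lt_of_le Nat.zero_lt_two S.two_le_N⟩
  let k : Fin S.N := ⟨1, lt_of_lt_of_le Nat.one_lt_two S.two_le_N⟩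
  have hjk : j ≠ k := by simp [j, k]
  have hm : ∀ i, ∃ s, s ≠ S.query i := fun i => by
    have : Nontrivial (Fin (S.numMeas i)) := Fin.nontrivial_iff_two_le.2 (S.two_le_numMeas i)
    exact exists_ne _
  obtain ⟨s, hs⟩ := hm j
  obtain ⟨t, ht⟩ := hm k
  exact prBox_notMem_quantum hjk hs ht
    (hsub (prBox_mem_localFriendliness hjk (by simp [h]) (by simp [h])))

theorem localFriendliness_eq_bellLocal_of_subset_quantum
    (h : S.localFriendliness ⊆ S.quantum) : S.bellLocal = S.localFriendliness := by
  refine bellLocal_subset_localFriendliness.antisymm ?_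
  let free : Fin S.N → Prop := fun i =>
    ∃ s₀ s₁ : Fin (S.numMeas i), s₀ ≠ s₁ ∧ (i ∈ S.friends → s₀ ≠ S.query i ∧ s₁ ≠ S.query i)
  have hfree : ∀ j k, j ≠ k → free j → ¬ free k := by
    rintro j k hjk ⟨s₀, s₁, hs, hs'⟩ ⟨t₀, t₁, ht, ht'⟩
    exact prBox_notMem_quantum hjk hs ht (h (prBox_mem_localFriendliness hjk hs' ht'))
  have hk : ∃ k, ∀ i, i ≠ k → ¬ free i := by
    -- The exceptional party is the free one if it exists, and an arbitrary one otherwise.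
    by_cases hex : ∃ k, free k
    · obtain ⟨k, hk⟩ := hex
      exact ⟨k, fun i hi => hfree k i hi.symm hk⟩
    · exact ⟨⟨0, lt_of_lt_of_le Nat.zero_lt_two S.two_le_N⟩, fun i _ hi => hex ⟨i, hi⟩⟩
  obtain ⟨k, hk⟩ := hk
  have hm : ∀ i, ∃ s, s ≠ S.query i := fun i => by
    have : Nontrivial (Fin (S.numMeas i)) := Fin.nontrivial_iff_two_le.2 (S.two_le_numMeas i)
    exact exists_ne _
  choose y hy using hm
  refine localFriendliness_subset_bellLocal (k := k) (y := y) (fun i hi => ?_) fun i hi s hs => ?_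
  -- Without a friend, any two measurements would make `i` free; with one, two measurements besides
  -- the query would.
  · by_contra hf
    exact hk i hi ⟨y i, S.query i, hy i, fun h => absurd h hf⟩
  · by_contra hne
    exact hk i hi ⟨s, y i, hne, fun _ => ⟨hs, hy i⟩⟩

end LFScenario

theorem mainTheorem9 (S : LFScenario) :
    (S.QuantumInsideLF ∨ S.LFInsideQuantum ∨ S.Incomparable) ∧
      ¬ (S.QuantumInsideLF ∧ S.LFInsideQuantum) ∧
      ¬ (S.QuantumInsideLF ∧ S.Incomparable) ∧
      ¬ (S.LFInsideQuantum ∧ S.Incomparable) ∧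
      (S.QuantumInsideLF ↔ S.friends = ∅) := by
  have hne : S.friends ≠ ∅ → ¬ S.quantum ⊆ S.localFriendliness := fun h =>
    LFScenario.not_quantum_subset_localFriendliness (Finset.nonempty_iff_ne_empty.2 h)
  refine ⟨?_, fun h => h.2.2.2 h.1.1.1, fun h => h.2.2 h.1.1.1, fun h => h.2.1 h.1.2.1,
    fun h => by_contra fun hf => hne hf h.1.1, LFScenario.quantumInsideLF_of_friends_eq_empty⟩
  by_cases hf : S.friends = ∅
  · exact .inl (LFScenario.quantumInsideLF_of_friends_eq_empty hf)
  · by_cases hsub : S.localFriendliness ⊆ S.quantum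
    · exact .inr (.inl ⟨LFScenario.localFriendliness_eq_bellLocal_of_subset_quantum hsub, hsub,
        hne hf⟩)
    · exact .inr (.inr ⟨hsub, hne hf⟩)
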